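/- Let $S(h)=\ell(h)+\ell(h)^*$, $h\in L^2(\mathbb{R}_+;\mathbb{R})$, be the semicircular operators on the full Fock space over $L^2(\mathbb{R}_+;\mathbb{C})$, let $\Omega$ be the vacuum vector, let $\tau(X)=\langle X\Omega,\Omega\rangle$, and let $\mathcal{SC}$ be the von Neumann algebra generated by all $S(h)$ (that is, by the free Brownian motion). Let $\nabla$ be the free Malliavin derivative, i.e. the closure, as an unbounded operator from $L^2(\mathcal{SC},\tau)$ to $L^2(\mathbb{R}_+;L^2(\mathcal{SC})\otimes L^2(\mathcal{SC}))$, of the derivation on the unital $*$-algebra generated by the $S(h)$ that satisfies $\nabla S(h)=h\cdot 1\otimes 1$ and $\nabla(XY)=X\cdot\nabla Y+\nabla X\cdot Y$ (left action on the left leg, right action on the right leg), and let $\mathbb{D}^{1,2}$ be its domain. Let $A\subset\mathbb{R}_+$ be a Borel set of finite Lebesgue measure and let $\mathcal{F}_A$ be the von Neumann subalgebra of $\mathcal{SC}$ generated by $\{S(\mathbf 1_B): B\subset A \text{ Borel}\}$. Denote by $\tau(\cdot|\mathcal{F}_A)$ the extension to $L^2(\mathcal{SC})$ of the trace-preserving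 conditional expectation onto $\mathcal{F}_A$ (the orthogonal projection onto $L^2(\mathcal{F}_A)$), and by $\tau\otimes\tau(\cdot|\mathcal{F}_A)$ the conditional expectation of $L^2(\mathcal{SC}\otimes\mathcal{SC}^{op})=L^2(\mathcal{SC})\otimes L^2(\mathcal{SC})$ onto $L^2(\mathcal{F}_A\otimes\mathcal{F}_A^{op})$. If $F\in\mathbb{D}^{1,2}$, then $\tau(F|\mathcal{F}_A)\in\mathbb{D}^{1,2}$ and, for almost every $t\ge 0$, $$\nabla_t\bigl(\tau(F|\mathcal{F}_A)\bigr)=\tau\otimes\tau\bigl(\nabla_tF\,\big|\,\mathcal{F}_A\bigr)\,\mathbf 1_A(t).$$ Moreover, if $F=\sum_{n\ge0}I_n(f_n)$ is the expansion of $F$ in multiple Wigner–Itô integrals, with $f_n\in L^2(\mathbb{R}_+^n)$, then $\tau(F|\mathcal{F}_A)=\sum_{n\ge0}I_n(f_n\mathbf 1_A^{\otimes n})$. -/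

import Mathlib

open MeasureTheory
open scoped ENNReal InnerProductSpace

namespace FreeWigner

noncomputable section

/-- Lebesgue measure on the half-line `[0, ∞)`, as a measure on `ℝ`. -/
def halfLine : Measure ℝ := volume.restrict (Set.Ici 0)

instance : SigmaFinite halfLine := by unfold halfLine; infer_instance

/-- The real Hilbert space `L²(ℝ₊; ℝ)`. -/
abbrev RealL2 : Type := Lp ℝ 2 halfLine

/-- The complex Hilbert space `L²(ℝ₊; ℂ)`, the complexification of `RealL2`. -/
abbrev ComplexL2 : Type := Lp ℂ 2 halfLine

/-- `L²(ℝ₊ⁿ; ℂ)`, which is the `n`-th Hilbert tensor power of `L²(ℝ₊; ℂ)`. -/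
abbrev ChaosL2 (n : ℕ) : Type := Lp ℂ 2 (Measure.pi fun _ : Fin n => halfLine)

/-- The full (free) Fock space `⨁ₙ L²(ℝ₊; ℂ)^{⊗n}` (Hilbert space direct sum). -/
abbrev Fock : Type := lp ChaosL2 2

/-- The inclusion `L²(ℝ₊; ℝ) ⊆ L²(ℝ₊; ℂ)`. -/
def complexify (h : RealL2) : ComplexL2 := Complex.ofRealCLM.compLp h

/-- The splitting `(t₀, …, tₙ) ↦ (t₀, (t₁, …, tₙ))`. -/
def splitEquiv (n : ℕ) : (Fin (n + 1) → ℝ) ≃ᵐ ℝ × (Fin n → ℝ) :=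
  MeasurableEquiv.piFinSuccAbove (fun _ => ℝ) 0

lemma splitEquiv_apply (n : ℕ) (t : Fin (n + 1) → ℝ) :
    splitEquiv n t = (t 0, fun i => t i.succ) := by
  rfl

lemma splitEquiv_preserving (n : ℕ) :
    MeasurePreserving (splitEquiv n) (Measure.pi fun _ : Fin (n + 1) => halfLine)
      (halfLine.prod (Measure.pi fun _ : Fin n => halfLine)) :=
  measurePreserving_piFinSuccAbove (fun _ : Fin (n + 1) => halfLine) 0

lemma memLp_tensor {n : ℕ} (h : ComplexL2) (f : ChaosL2 n) :
    MemLp (fun t : Fin (n + 1) → ℝ => h (t 0) * f (fun i => t i.succ)) 2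
      (Measure.pi fun _ : Fin (n + 1) => halfLine) := by
  have hprod : MemLp (fun z : ℝ × (Fin n → ℝ) => h z.1 * f z.2) 2
      (halfLine.prod (Measure.pi fun _ : Fin n => halfLine)) := by
    have hm : AEStronglyMeasurable (fun z : ℝ × (Fin n → ℝ) => h z.1 * f z.2)
        (halfLine.prod (Measure.pi fun _ : Fin n => halfLine)) :=
      (Lp.aestronglyMeasurable h).comp_fst.mul (Lp.aestronglyMeasurable f).comp_snd
    rw [memLp_two_iff_integrable_sq_norm hm]
    simp only [norm_mul, mul_pow]
    exact ((Lp.memLp h).integrable_norm_pow two_ne_zero).mul_prod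
      ((Lp.memLp f).integrable_norm_pow two_ne_zero)
  exact hprod.comp_measurePreserving (splitEquiv_preserving n)

/-- The elementary tensor `h ⊗ f ∈ L²(ℝ₊ⁿ⁺¹)`, that is
`(t₀, …, tₙ) ↦ h(t₀) f(t₁, …, tₙ)`. -/
def tensor {n : ℕ} (h : ComplexL2) (f : ChaosL2 n) : ChaosL2 (n + 1) :=
  (memLp_tensor h f).toLp _

lemma tensor_coe {n : ℕ} (h : ComplexL2) (f : ChaosL2 n) :
    tensor h f =ᵐ[Measure.pi fun _ : Fin (n + 1) => halfLine]
      fun t => h (t 0) * f (fun i => t i.succ) :=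
  (memLp_tensor h f).coeFn_toLp

lemma ae_head {p : ℝ → Prop} (n : ℕ) (hp : ∀ᵐ x ∂halfLine, p x) :
    ∀ᵐ t ∂(Measure.pi fun _ : Fin (n + 1) => halfLine), p (t 0) :=
  (Measure.quasiMeasurePreserving_fst.comp
    (splitEquiv_preserving n).quasiMeasurePreserving).ae hp

lemma ae_tail {n : ℕ} {p : (Fin n → ℝ) → Prop}
    (hp : ∀ᵐ x ∂(Measure.pi fun _ : Fin n => halfLine), p x) :
    ∀ᵐ t ∂(Measure.pi fun _ : Fin (n + 1) => halfLine), p (fun i => t i.succ) :=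
  (Measure.quasiMeasurePreserving_snd.comp
    (splitEquiv_preserving n).quasiMeasurePreserving).ae hp

lemma tensor_add {n : ℕ} (h : ComplexL2) (f g : ChaosL2 n) :
    tensor h (f + g) = tensor h f + tensor h g := by
  apply Lp.ext
  filter_upwards [tensor_coe h (f + g), tensor_coe h f, tensor_coe h g,
    Lp.coeFn_add (tensor h f) (tensor h g), ae_tail (Lp.coeFn_add f g)] with t h1 h2 h3 h4 h5
  rw [h1, h4, Pi.add_apply, h2, h3, h5, Pi.add_apply, mul_add]

lemma tensor_smul {n : ℕ} (h : ComplexL2) (c : ℂ) (f : ChaosL2 n) :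
    tensor h (c • f) = c • tensor h f := by
  apply Lp.ext
  filter_upwards [tensor_coe h (c • f), tensor_coe h f,
    Lp.coeFn_smul c (tensor h f), ae_tail (Lp.coeFn_smul c f)] with t h1 h2 h4 h5
  rw [h1, h4, Pi.smul_apply, h2, h5, Pi.smul_apply, smul_eq_mul, smul_eq_mul]
  ring

lemma inner_tensor_left {n : ℕ} (h : ComplexL2) (f : ChaosL2 n) (g : ChaosL2 (n + 1)) :
    ⟪tensor h f, g⟫_ℂ = ∫ z, starRingEnd ℂ (h z.1 * f z.2) * g ((splitEquiv n).symm z)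
      ∂(halfLine.prod (Measure.pi fun _ : Fin n => halfLine)) := by
  rw [L2.inner_def, ← (splitEquiv_preserving n).integral_comp']
  apply integral_congr_ae
  filter_upwards [tensor_coe h f] with t ht
  rw [ht, MeasurableEquiv.symm_apply_apply, splitEquiv_apply, RCLike.inner_apply, mul_comm]

lemma inner_tensor {n : ℕ} (h h' : ComplexL2) (f f' : ChaosL2 n) :
    ⟪tensor h f, tensor h' f'⟫_ℂ = ⟪h, h'⟫_ℂ * ⟪f, f'⟫_ℂ := by
  rw [L2.inner_def, L2.inner_def, L2.inner_def, ← integral_prod_mul,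
    ← (splitEquiv_preserving n).integral_comp']
  apply integral_congr_ae
  filter_upwards [tensor_coe h f, tensor_coe h' f'] with t h1 h2
  simp only [h1, h2, splitEquiv_apply, RCLike.inner_apply, map_mul]
  ring

lemma norm_tensor {n : ℕ} (h : ComplexL2) (f : ChaosL2 n) : ‖tensor h f‖ = ‖h‖ * ‖f‖ := by
  have : ‖tensor h f‖ ^ 2 = (‖h‖ * ‖f‖) ^ 2 := by
    have h1 := inner_tensor h h f f
    simp only [inner_self_eq_norm_sq_to_K] at h1
    rw [mul_pow]
    exact_mod_cast h1
  exact (pow_left_inj₀ (norm_nonneg _) (by positivity) two_ne_zero).1 this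

/-- The components of the left creation operator applied to `x`:
`0` in degree `0` and `h ⊗ xₙ` in degree `n + 1`. -/
def creationFun (h : ComplexL2) (x : Fock) : (n : ℕ) → ChaosL2 n
  | 0 => 0
  | n + 1 => tensor h (x n)

lemma hasSum_norm_sq (x : Fock) : HasSum (fun n => ‖x n‖ ^ 2) (‖x‖ ^ 2) := by
  have := lp.hasSum_norm (p := 2) (by norm_num) x
  simpa using this

lemma hasSum_creationFun (h : ComplexL2) (x : Fock) :
    HasSum (fun n => ‖creationFun h x n‖ ^ 2) ((‖h‖ * ‖x‖) ^ 2) := by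
  rw [← hasSum_nat_add_iff' 1]
  simp only [creationFun, norm_tensor, mul_pow, Finset.range_one, Finset.sum_singleton, norm_zero]
  simpa using (hasSum_norm_sq x).mul_left (‖h‖ ^ 2)

/-- The left creation operator `ℓ(h)` on the full Fock space:
`ℓ(h)(g₁ ⊗ ⋯ ⊗ gₙ) = h ⊗ g₁ ⊗ ⋯ ⊗ gₙ`. -/
def creation (h : ComplexL2) : Fock →L[ℂ] Fock :=
  LinearMap.mkContinuous
    { toFun := fun x => ⟨creationFun h x, memℓp_gen (by
        simpa using (hasSum_creationFun h x).summable)⟩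
      map_add' := fun x y => by
        ext1; funext n
        cases n with
        | zero => exact (add_zero (0 : ChaosL2 0)).symm
        | succ n => exact tensor_add h (x n) (y n)
      map_smul' := fun c x => by
        ext1; funext n
        cases n with
        | zero => exact (smul_zero c : c • (0 : ChaosL2 0) = 0).symm
        | succ n => exact tensor_smul h c (x n) }
    ‖h‖ (fun x => by
      refine le_of_eq ((pow_left_inj₀ (norm_nonneg _) (by positivity) two_ne_zero).1 ?_)
      exact (hasSum_norm_sq _).unique (hasSum_creationFun h x))

lemma creation_apply_zero (h : ComplexL2) (x : Fock) : creation h x 0 = 0 := rfl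

lemma creation_apply_succ (h : ComplexL2) (x : Fock) (n : ℕ) :
    creation h x (n + 1) = tensor h (x n) := rfl

/-- The constant function `1 ∈ L²(ℝ₊⁰) = ℂ`. -/
def one0 : ChaosL2 0 :=
  indicatorConstLp 2 MeasurableSet.univ (by simp) 1

/-- The multiple Wigner-Itô integral `Iₙ : L²(ℝ₊ⁿ) → L²(SC)`, where `L²(SC)` is the Fock space
through `X ↦ XΩ` (see `gns_SC`). It is the isometry sending `h₁ ⊗ ⋯ ⊗ hₙ` to the projection of
`S(h₁) ⋯ S(hₙ)` onto the tensors of length `n` (see `wignerIntegral_word`). -/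
def wignerIntegral (n : ℕ) (f : ChaosL2 n) : Fock := lp.single 2 n f

/-- The vacuum vector `Ω`. -/
def vacuum : Fock := wignerIntegral 0 one0

/-- The semicircular operator `S(h) = ℓ(h) + ℓ(h)*`, `h ∈ L²(ℝ₊; ℝ)`. -/
def semicircular (h : RealL2) : Fock →L[ℂ] Fock :=
  creation (complexify h) + (creation (complexify h)).adjoint

/-- The von Neumann algebra generated by a set `s` of bounded operators on a Hilbert space,
i.e. the double commutant of `s ∪ s*`. -/
def generatedBy {H : Type*} [NormedAddCommGroup H] [InnerProductSpace ℂ H] [CompleteSpace H]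
    (s : Set (H →L[ℂ] H)) : VonNeumannAlgebra H where
  toStarSubalgebra :=
    StarSubalgebra.centralizer ℂ (StarSubalgebra.centralizer ℂ s : Set (H →L[ℂ] H))
  centralizer_centralizer' := by
    change Set.centralizer (Set.centralizer
      (StarSubalgebra.centralizer ℂ (StarSubalgebra.centralizer ℂ s : Set (H →L[ℂ] H)) :
        Set (H →L[ℂ] H))) = _
    rw [StarSubalgebra.coe_centralizer, Set.centralizer_centralizer_centralizer]
    rfl

/-- The Hilbert space tensor product of two copies of the Fock space. With `L²(SC)` identified with
the Fock space by `X ↦ XΩ`, this is `L²(SC) ⊗ L²(SC) = L²(SC ⊗ SCᵒᵖ, τ ⊗ τᵒᵖ)`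
(recall that `τ` is tracial, so that `X ↦ XΩ` is isometric for `τᵒᵖ` as well). -/
abbrev FockTensor : Type := UniformSpace.Completion (TensorProduct ℂ Fock Fock)

/-- The square integrable biprocesses `L²(ℝ₊; L²(SC) ⊗ L²(SC))`. -/
abbrev Biprocess : Type := Lp FockTensor 2 halfLine

/-- The elementary tensor `x ⊗ y`. -/
def tmul (x y : Fock) : FockTensor :=
  ((TensorProduct.tmul ℂ x y : TensorProduct ℂ Fock Fock) : FockTensor)

/-- The biprocess `t ↦ h(t) v`. -/
def simpleBiprocess (h : RealL2) (v : FockTensor) : Biprocess :=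
  (ContinuousLinearMap.toSpanSingleton ℝ v).compLp h

/-- The product `S(h₁) ⋯ S(hₙ)`. These products span the unital `*`-algebra generated by the
semicircular operators. -/
def word (w : List RealL2) : Fock →L[ℂ] Fock := (w.map semicircular).prod

/-- The gradient of `S(h₁) ⋯ S(hₙ)`, that is
`∑ₖ hₖ · S(h₁) ⋯ S(hₖ₋₁) ⊗ S(hₖ₊₁) ⋯ S(hₙ)`. This is what `∇ S(h) = h · 1 ⊗ 1` and the derivation
property `∇(AB) = A · ∇B + ∇A · B` prescribe, the left action being on the left leg and the right
action on the right leg. -/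
def gradWord (w : List RealL2) : Biprocess :=
  ∑ k : Fin w.length,
    simpleBiprocess (w.get k) (tmul (word (w.take k) vacuum) (word (w.drop (k + 1)) vacuum))

lemma one0_inner : ⟪one0, one0⟫_ℂ = 1 := by
  unfold one0
  rw [L2.inner_indicatorConstLp_indicatorConstLp (hμs := by simp) (hμt := by simp)]
  simp [measureReal_def]

lemma inner_vacuum_vacuum : ⟪vacuum, vacuum⟫_ℂ = 1 := by
  unfold vacuum wignerIntegral
  rw [lp.inner_single_left, lp.single_apply_self, one0_inner]

lemma inner_creation_creation (h h' : ComplexL2) (x y : Fock) :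
    ⟪creation h x, creation h' y⟫_ℂ = ⟪h, h'⟫_ℂ * ⟪x, y⟫_ℂ := by
  refine (lp.hasSum_inner (creation h x) (creation h' y)).unique ?_
  have h1 := (lp.hasSum_inner x y).mul_left ⟪h, h'⟫_ℂ
  refine (hasSum_nat_add_iff' (f := fun n => ⟪creation h x n, creation h' y n⟫_ℂ) 1).1 ?_
  have h2 : ⟪creation h x 0, creation h' y 0⟫_ℂ = 0 := inner_zero_left _
  have h3 : ∀ n, ⟪creation h x (n + 1), creation h' y (n + 1)⟫_ℂ = ⟪h, h'⟫_ℂ * ⟪x n, y n⟫_ℂ :=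
    fun n => inner_tensor h h' (x n) (y n)
  rw [Finset.sum_range_one, h2, sub_zero]
  simp only [h3]
  exact h1

lemma inner_creation_vacuum (h : ComplexL2) (x : Fock) : ⟪creation h x, vacuum⟫_ℂ = 0 := by
  unfold vacuum wignerIntegral
  rw [lp.inner_single_right, creation_apply_zero, inner_zero_left]

lemma adjoint_creation_creation (h h' : ComplexL2) (x : Fock) :
    (creation h).adjoint (creation h' x) = ⟪h, h'⟫_ℂ • x := by
  refine ext_inner_left ℂ fun y => ?_
  rw [ContinuousLinearMap.adjoint_inner_right, inner_creation_creation, inner_smul_right]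

lemma adjoint_creation_vacuum (h : ComplexL2) : (creation h).adjoint vacuum = 0 := by
  refine ext_inner_left ℂ fun y => ?_
  rw [ContinuousLinearMap.adjoint_inner_right, inner_creation_vacuum, inner_zero_right]

lemma inner_semicircular (h : RealL2) (x y : Fock) :
    ⟪x, semicircular h y⟫_ℂ = ⟪semicircular h x, y⟫_ℂ := by
  simp only [semicircular, add_apply, inner_add_left, inner_add_right,
    ContinuousLinearMap.adjoint_inner_left, ContinuousLinearMap.adjoint_inner_right]
  ring

/-- The elementary tensor `f₁ ⊗ ⋯ ⊗ fₙ` in the Fock space. -/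
def elem (f : List ComplexL2) : Fock := f.foldr (fun h x => creation h x) vacuum

lemma elem_cons (h : ComplexL2) (f : List ComplexL2) : elem (h :: f) = creation h (elem f) := rfl

lemma inner_tmul (a b c d : Fock) : ⟪tmul a b, tmul c d⟫_ℂ = ⟪a, c⟫_ℂ * ⟪b, d⟫_ℂ := by
  unfold tmul
  rw [UniformSpace.Completion.inner_coe, TensorProduct.inner_tmul]

lemma inner_simpleBiprocess (h h' : RealL2) (v v' : FockTensor) :
    ⟪simpleBiprocess h v, simpleBiprocess h' v'⟫_ℂ
      = ⟪complexify h, complexify h'⟫_ℂ * ⟪v, v'⟫_ℂ := by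
  rw [L2.inner_def, L2.inner_def, ← integral_mul_const]
  apply integral_congr_ae
  filter_upwards [ContinuousLinearMap.coeFn_compLp (ContinuousLinearMap.toSpanSingleton ℝ v) h,
    ContinuousLinearMap.coeFn_compLp (ContinuousLinearMap.toSpanSingleton ℝ v') h',
    ContinuousLinearMap.coeFn_compLp Complex.ofRealCLM h,
    ContinuousLinearMap.coeFn_compLp Complex.ofRealCLM h'] with t h1 h2 h3 h4
  unfold simpleBiprocess complexify
  rw [h1, h2, h3, h4]
  simp only [ContinuousLinearMap.toSpanSingleton_apply, Complex.ofRealCLM_apply,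
    RCLike.inner_apply, Complex.conj_ofReal]
  rw [← Complex.coe_smul, ← Complex.coe_smul, inner_smul_left, inner_smul_right,
    Complex.conj_ofReal]
  ring

lemma word_cons (h : RealL2) (w : List RealL2) (x : Fock) :
    word (h :: w) x = semicircular h (word w x) := by
  simp [word]

/-- The pairing of the gradient of a word with an elementary biprocess, as a sum of scalars. -/
def pairing (a b : Fock) (h : RealL2) (w : List RealL2) : ℂ :=
  ∑ k : Fin w.length, ⟪complexify h, complexify (w.get k)⟫_ℂ *
    (⟪a, word (w.take k) vacuum⟫_ℂ * ⟪b, word (w.drop (k + 1)) vacuum⟫_ℂ)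

lemma inner_gradWord (a b : Fock) (h : RealL2) (w : List RealL2) :
    ⟪simpleBiprocess h (tmul a b), gradWord w⟫_ℂ = pairing a b h w := by
  simp only [gradWord, pairing, inner_sum, inner_simpleBiprocess, inner_tmul]

lemma pairing_cons (a b : Fock) (h h1 : RealL2) (w : List RealL2) :
    pairing a b h (h1 :: w) = ⟪complexify h, complexify h1⟫_ℂ *
      (⟪a, vacuum⟫_ℂ * ⟪b, word w vacuum⟫_ℂ) + pairing (semicircular h1 a) b h w := by
  unfold pairing
  simp only [List.length_cons]
  rw [Fin.sum_univ_succ]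
  congr 1
  apply Finset.sum_congr rfl
  intro k _
  simp [word_cons, inner_semicircular]

lemma pairing_add (a a' b : Fock) (h : RealL2) (w : List RealL2) :
    pairing (a + a') b h w = pairing a b h w + pairing a' b h w := by
  simp only [pairing, inner_add_left, ← Finset.sum_add_distrib]
  exact Finset.sum_congr rfl fun _ _ => by ring

lemma pairing_smul (c : ℂ) (a b : Fock) (h : RealL2) (w : List RealL2) :
    pairing (c • a) b h w = starRingEnd ℂ c * pairing a b h w := by
  simp only [pairing, inner_smul_left, Finset.mul_sum]
  exact Finset.sum_congr rfl fun _ _ => by ring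

/-- Integration by parts against elementary biprocesses. -/
lemma pairing_elem (h : RealL2) (g : List ComplexL2) (w : List RealL2) :
    ∀ f : List ComplexL2, pairing (elem f) (elem g) h w
      = ⟪elem (f ++ complexify h :: g), word w vacuum⟫_ℂ := by
  induction w with
  | nil =>
    intro f
    have h0 : pairing (elem f) (elem g) h [] = 0 := by simp [pairing]
    rw [h0]
    have : word [] vacuum = vacuum := by simp [word]
    rw [this]
    cases f with
    | nil => exact (inner_creation_vacuum _ _).symm
    | cons f0 f => exact (inner_creation_vacuum _ _).symm
  | cons h1 w ih =>
    intro f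
    rw [pairing_cons, word_cons, inner_semicircular]
    have e1 := ih (complexify h1 :: f)
    simp only [semicircular, add_apply, pairing_add, inner_add_left]
    rw [elem_cons, List.cons_append, elem_cons] at e1
    rw [e1]
    cases f with
    | nil =>
      have e0 : elem [] = vacuum := rfl
      rw [e0, adjoint_creation_vacuum, inner_vacuum_vacuum, List.nil_append, elem_cons,
        adjoint_creation_creation, inner_smul_left, inner_conj_symm]
      have : pairing 0 (elem g) h w = 0 := by simp [pairing]
      rw [this]; ring
    | cons f0 f =>
      rw [elem_cons, inner_creation_vacuum, List.cons_append, elem_cons,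
        adjoint_creation_creation, adjoint_creation_creation, pairing_smul, ih f,
        inner_smul_left]
      ring

lemma ae_eq_zero_of_rectangles {X Y : Type*} [MeasurableSpace X] [MeasurableSpace Y]
    {μ : Measure X} {ν : Measure Y} [SigmaFinite μ] [SigmaFinite ν] {g : X × Y → ℂ}
    (hg : MemLp g 2 (μ.prod ν))
    (h : ∀ s t, MeasurableSet s → MeasurableSet t → μ s ≠ ∞ → ν t ≠ ∞ →
      ∫ z in s ×ˢ t, g z ∂(μ.prod ν) = 0) :
    g =ᵐ[μ.prod ν] 0 := by
  set Q : ℕ × ℕ → Set (X × Y) := fun i => spanningSets μ i.1 ×ˢ spanningSets ν i.2 with hQ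
  have hQm : ∀ i, MeasurableSet (Q i) := fun i =>
    (measurableSet_spanningSets μ i.1).prod (measurableSet_spanningSets ν i.2)
  have hQu : ⋃ i, Q i = Set.univ := by
    ext z
    simp only [Set.mem_iUnion, Set.mem_univ, iff_true]
    have h1 : z.1 ∈ ⋃ i, spanningSets μ i := by rw [iUnion_spanningSets]; trivial
    have h2 : z.2 ∈ ⋃ i, spanningSets ν i := by rw [iUnion_spanningSets]; trivial
    obtain ⟨i, hi⟩ := Set.mem_iUnion.1 h1
    obtain ⟨j, hj⟩ := Set.mem_iUnion.1 h2
    exact ⟨(i, j), hi, hj⟩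
  have hfin : ∀ i, (μ.prod ν) (Q i) < ∞ := fun i => by
    rw [hQ, Measure.prod_prod]
    exact ENNReal.mul_lt_top (measure_spanningSets_lt_top μ i.1)
      (measure_spanningSets_lt_top ν i.2)
  have key : ∀ i, g =ᵐ[(μ.prod ν).restrict (Q i)] 0 := by
    intro i
    have : IsFiniteMeasure ((μ.prod ν).restrict (Q i)) := ⟨by simpa using hfin i⟩
    have hint : Integrable g ((μ.prod ν).restrict (Q i)) := (hg.restrict (Q i)).integrable (by simp)
    have hrect : ∀ s t, MeasurableSet s → MeasurableSet t →
        ∫ z in s ×ˢ t, g z ∂((μ.prod ν).restrict (Q i)) = 0 := by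
      intro s t hs ht
      rw [Measure.restrict_restrict (hs.prod ht), Set.prod_inter_prod]
      refine h _ _ (hs.inter (measurableSet_spanningSets μ i.1))
        (ht.inter (measurableSet_spanningSets ν i.2)) ?_ ?_
      · exact ((measure_mono Set.inter_subset_right).trans_lt
          (measure_spanningSets_lt_top μ i.1)).ne
      · exact ((measure_mono Set.inter_subset_right).trans_lt
          (measure_spanningSets_lt_top ν i.2)).ne
    have htot : ∫ z, g z ∂((μ.prod ν).restrict (Q i)) = 0 := by
      have := hrect Set.univ Set.univ MeasurableSet.univ MeasurableSet.univ
      rwa [Set.univ_prod_univ, Measure.restrict_univ] at this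
    refine hint.ae_eq_zero_of_forall_setIntegral_eq_zero fun s hs _ => ?_
    induction s, hs using MeasurableSpace.induction_on_inter generateFrom_prod.symm
      isPiSystem_prod with
    | empty => simp
    | basic s hs =>
      obtain ⟨a, ha, b, hb, rfl⟩ := hs
      exact hrect a b ha hb
    | compl s hs ih =>
      have := integral_add_compl hs hint
      rw [ih (measure_lt_top _ _), htot, zero_add] at this
      exact this
    | iUnion f hd hf ih =>
      rw [integral_iUnion hf hd hint.integrableOn]
      simp [ih]
  have : g =ᵐ[(μ.prod ν).restrict (⋃ i, Q i)] 0 :=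
    (ae_restrict_iUnion_iff Q (fun z => g z = (0 : X × Y → ℂ) z)).2 key
  rwa [hQu, Measure.restrict_univ] at this

lemma eq_zero_of_inner_tensor {n : ℕ} (g : ChaosL2 (n + 1))
    (h : ∀ (a : ComplexL2) (f : ChaosL2 n), ⟪tensor a f, g⟫_ℂ = 0) : g = 0 := by
  have hG : MemLp (fun z => g ((splitEquiv n).symm z)) 2
      (halfLine.prod (Measure.pi fun _ : Fin n => halfLine)) :=
    (Lp.memLp g).comp_measurePreserving ((splitEquiv_preserving n).symm)
  have h0 := ae_eq_zero_of_rectangles hG (fun s t hs ht hμs hνt => by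
    have h1 := h (indicatorConstLp 2 hs hμs 1) (indicatorConstLp 2 ht hνt 1)
    rw [inner_tensor_left] at h1
    rw [← integral_indicator (hs.prod ht), ← h1]
    apply integral_congr_ae
    filter_upwards [Measure.quasiMeasurePreserving_fst.ae
        (indicatorConstLp_coeFn (p := 2) (hs := hs) (hμs := hμs) (c := (1 : ℂ))),
      Measure.quasiMeasurePreserving_snd.ae
        (indicatorConstLp_coeFn (p := 2) (hs := ht) (hμs := hνt) (c := (1 : ℂ)))] with z h1 h2
    rw [h1, h2]
    by_cases hz1 : z.1 ∈ s <;> by_cases hz2 : z.2 ∈ t <;> simp [Set.indicator, hz1, hz2])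
  apply Lp.ext
  have h2 := (splitEquiv_preserving n).quasiMeasurePreserving.ae h0
  filter_upwards [h2, Lp.coeFn_zero ℂ 2 (Measure.pi fun _ : Fin (n + 1) => halfLine)] with t h3 h4
  rw [h4]
  simpa using h3

lemma integral_pi_zero (φ : (Fin 0 → ℝ) → ℂ) :
    ∫ t, φ t ∂(Measure.pi fun _ : Fin 0 => halfLine) = φ default := by
  rw [Measure.pi_of_empty (x := default), integral_dirac]

lemma eq_zero_of_inner_one0 (g : ChaosL2 0) (h : ⟪one0, g⟫_ℂ = 0) : g = 0 := by
  unfold one0 at h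
  rw [L2.inner_indicatorConstLp_one, Measure.restrict_univ, integral_pi_zero] at h
  apply Lp.ext
  filter_upwards [Lp.coeFn_zero ℂ 2 (Measure.pi fun _ : Fin 0 => halfLine)] with t h4
  rw [h4, Subsingleton.elim t default, h, Pi.zero_apply]

lemma inner_wignerIntegral (n : ℕ) (f : ChaosL2 n) (x : Fock) :
    ⟪wignerIntegral n f, x⟫_ℂ = ⟪f, x n⟫_ℂ := lp.inner_single_left n f x

lemma creation_wignerIntegral (n : ℕ) (h : ComplexL2) (f : ChaosL2 n) :
    creation h (wignerIntegral n f) = wignerIntegral (n + 1) (tensor h f) := by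
  have ht0 : ∀ m, tensor h (0 : ChaosL2 m) = 0 := fun m => by
    simpa using tensor_smul h 0 (0 : ChaosL2 m)
  ext1; funext m
  cases m with
  | zero =>
    rw [creation_apply_zero]
    exact (lp.single_apply_ne (E := ChaosL2) 2 (n + 1) (tensor h f) (Nat.succ_ne_zero n).symm).symm
  | succ m =>
    rw [creation_apply_succ]
    unfold wignerIntegral
    by_cases hm : m = n
    · subst hm
      rw [lp.single_apply_self, lp.single_apply_self]
    · rw [lp.single_apply_ne (E := ChaosL2) 2 n f hm,
        lp.single_apply_ne (E := ChaosL2) 2 (n + 1) (tensor h f) (by simpa using hm), ht0]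

lemma eq_zero_of_inner_elem (x : Fock) (hx : ∀ l, ⟪elem l, x⟫_ℂ = 0) : x = 0 := by
  have key : ∀ (n : ℕ) (x : Fock), (∀ l, ⟪elem l, x⟫_ℂ = 0) → x n = 0 := by
    intro n
    induction n with
    | zero =>
      intro x hx
      apply eq_zero_of_inner_one0
      rw [← inner_wignerIntegral]
      exact hx []
    | succ n ih =>
      intro x hx
      apply eq_zero_of_inner_tensor
      intro h f
      rw [← inner_wignerIntegral, ← creation_wignerIntegral,
        ← ContinuousLinearMap.adjoint_inner_right, inner_wignerIntegral,
        ih _ fun l => by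
          rw [ContinuousLinearMap.adjoint_inner_right]
          exact hx (h :: l), inner_zero_right]
  ext1; funext n
  exact key n x hx

lemma dense_span_elem : Dense (Submodule.span ℂ (Set.range elem) : Set Fock) := by
  rw [Submodule.dense_iff_topologicalClosure_eq_top, Submodule.topologicalClosure_eq_top_iff,
    Submodule.eq_bot_iff]
  intro x hx
  exact eq_zero_of_inner_elem x fun l => hx _ (Submodule.subset_span ⟨l, rfl⟩)

lemma eq_zero_of_inner_tmul_elem (v : FockTensor)
    (hv : ∀ f g, ⟪tmul (elem f) (elem g), v⟫_ℂ = 0) : v = 0 := by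
  let T : Fock →L[ℂ] Fock →L[ℂ] TensorProduct ℂ Fock Fock := TensorProduct.mkL ℂ Fock Fock
  let C : TensorProduct ℂ Fock Fock →L[ℂ] FockTensor := UniformSpace.Completion.toComplL
  have h1 : ∀ f b, ⟪v, tmul (elem f) b⟫_ℂ = 0 := by
    intro f b
    have : (innerSL ℂ v) ∘L C ∘L (T (elem f)) = 0 := by
      refine ContinuousLinearMap.ext_on dense_span_elem ?_
      rintro _ ⟨g, rfl⟩
      exact inner_eq_zero_symm.1 (hv f g)
    exact DFunLike.congr_fun this b
  have h2 : ∀ a b, ⟪v, tmul a b⟫_ℂ = 0 := by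
    intro a b
    have : (innerSL ℂ v) ∘L C ∘L (T.flip b) = 0 := by
      refine ContinuousLinearMap.ext_on dense_span_elem ?_
      rintro _ ⟨f, rfl⟩
      exact h1 f b
    exact DFunLike.congr_fun this a
  refine ext_inner_left ℂ fun y => ?_
  rw [inner_zero_right]
  induction y using UniformSpace.Completion.induction_on with
  | hp => exact isClosed_eq (Continuous.inner continuous_id continuous_const) continuous_const
  | ih y =>
    induction y using TensorProduct.induction_on with
    | zero => rw [UniformSpace.Completion.coe_zero, inner_zero_left]
    | tmul a b => exact inner_eq_zero_symm.1 (h2 a b)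
    | add a b ha hb => rw [UniformSpace.Completion.coe_add, inner_add_left, ha, hb, add_zero]

lemma simpleBiprocess_indicator {s : Set ℝ} (hs : MeasurableSet s) (hμs : halfLine s ≠ ∞)
    (v : FockTensor) :
    simpleBiprocess (indicatorConstLp 2 hs hμs 1) v = indicatorConstLp 2 hs hμs v := by
  apply Lp.ext
  unfold simpleBiprocess
  filter_upwards [ContinuousLinearMap.coeFn_compLp (ContinuousLinearMap.toSpanSingleton ℝ v)
      (indicatorConstLp 2 hs hμs (1 : ℝ)),
    indicatorConstLp_coeFn (p := 2) (hs := hs) (hμs := hμs) (c := (1 : ℝ)),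
    indicatorConstLp_coeFn (p := 2) (hs := hs) (hμs := hμs) (c := v)] with t h1 h2 h3
  rw [h1, h2, h3]
  by_cases ht : t ∈ s <;> simp [Set.indicator, ht]

lemma eq_zero_of_inner_simpleBiprocess (U : Biprocess)
    (hU : ∀ h f g, ⟪simpleBiprocess h (tmul (elem f) (elem g)), U⟫_ℂ = 0) : U = 0 := by
  apply Lp.ext
  refine Filter.EventuallyEq.trans ?_ (Lp.coeFn_zero FockTensor 2 halfLine).symm
  refine Lp.ae_eq_zero_of_forall_setIntegral_eq_zero U (by simp) (by simp) ?_ ?_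
  · intro s hs hμs
    exact integrableOn_Lp_of_measure_ne_top U (by norm_num) hμs.ne
  · intro s hs hμs
    apply eq_zero_of_inner_tmul_elem
    intro f g
    have := hU (indicatorConstLp 2 hs hμs.ne 1) f g
    rwa [simpleBiprocess_indicator,
      L2.inner_indicatorConstLp_eq_inner_setIntegral] at this

/-- The closure, in `L²(SC) × L²(ℝ₊; L²(SC) ⊗ L²(SC))`, of the graph of the free Malliavin
derivative on the unital `*`-algebra generated by the semicircular operators. -/
def malliavinGraph : Submodule ℂ (Fock × Biprocess) :=
  (Submodule.span ℂ
    (Set.range fun w : List RealL2 => (word w vacuum, gradWord w))).topologicalClosure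

lemma inner_of_mem_malliavinGraph (h : RealL2) (f g : List ComplexL2) {p : Fock × Biprocess}
    (hp : p ∈ malliavinGraph) :
    ⟪simpleBiprocess h (tmul (elem f) (elem g)), p.2⟫_ℂ
      = ⟪elem (f ++ complexify h :: g), p.1⟫_ℂ := by
  have hcl : IsClosed {p : Fock × Biprocess |
      ⟪simpleBiprocess h (tmul (elem f) (elem g)), p.2⟫_ℂ
        = ⟪elem (f ++ complexify h :: g), p.1⟫_ℂ} :=
    isClosed_eq (Continuous.inner continuous_const continuous_snd)
      (Continuous.inner continuous_const continuous_fst)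
  refine closure_minimal ?_ hcl hp
  intro q hq
  induction hq using Submodule.span_induction with
  | mem q hq =>
    obtain ⟨w, rfl⟩ := hq
    exact (inner_gradWord _ _ h w).trans (pairing_elem h g w f)
  | zero => simp
  | add a b _ _ ha hb =>
    simp only [Set.mem_ofPred_eq, Prod.fst_add, Prod.snd_add, inner_add_right] at *
    rw [ha, hb]
  | smul c a _ ha =>
    simp only [Set.mem_ofPred_eq, Prod.smul_fst, Prod.smul_snd, inner_smul_right] at *
    rw [ha]

/-- The free Malliavin derivative is well defined and closable. -/
lemma malliavinGraph_singleValued (p : Fock × Biprocess) (hp : p ∈ malliavinGraph)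
    (h0 : p.1 = 0) : p.2 = 0 := by
  refine eq_zero_of_inner_simpleBiprocess p.2 fun h f g => ?_
  rw [inner_of_mem_malliavinGraph h f g hp, h0, inner_zero_right]

/-- The free Malliavin derivative `∇`, as a closed unbounded operator from `L²(SC)` to
`L²(ℝ₊; L²(SC) ⊗ L²(SC))`: the closure of the derivation on the unital `*`-algebra generated by the
semicircular operators. -/
def malliavin : Fock →ₗ.[ℂ] Biprocess := malliavinGraph.toLinearPMap

/-- The space `𝔻^{1,2}`: the domain of `∇`, which is the completion of the unital `*`-algebra
generated by the semicircular operators for the graph norm `(‖F‖² + ‖∇F‖²)^{1/2}`. -/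
def D12 : Submodule ℂ Fock := malliavin.domain

/-- `∇F` for `F ∈ 𝔻^{1,2}`. -/
def grad (F : D12) : Biprocess := malliavin F

lemma malliavin_graph : malliavin.graph = malliavinGraph :=
  Submodule.toLinearPMap_graph_eq _ malliavinGraph_singleValued

/-- `π_n(S(h₁) ⋯ S(hₙ)) = Iₙ(h₁ ⊗ ⋯ ⊗ hₙ)`: the projection of the product `S(h₁) ⋯ S(hₙ)` onto
tensors of length `n` is the multiple integral of `h₁ ⊗ ⋯ ⊗ hₙ`. -/
lemma wignerIntegral_word (w : List RealL2) :
    wignerIntegral w.length (word w vacuum w.length) = elem (w.map complexify) := by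
  have hadj : ∀ (h : ComplexL2) (x : Fock) (n : ℕ), x (n + 1) = 0 →
      (creation h).adjoint x n = 0 := by
    intro h x n hx
    refine ext_inner_left ℂ fun f => ?_
    rw [← inner_wignerIntegral, ContinuousLinearMap.adjoint_inner_right,
      creation_wignerIntegral, inner_wignerIntegral, hx, inner_zero_right, inner_zero_right]
  have ht0 : ∀ (h : ComplexL2) m, tensor h (0 : ChaosL2 m) = 0 := fun h m => by
    simpa using tensor_smul h 0 (0 : ChaosL2 m)
  have hadd : ∀ (h : RealL2) (x : Fock) (n : ℕ), semicircular h x n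
      = creation (complexify h) x n + (creation (complexify h)).adjoint x n := fun h x n => rfl
  have hhigh : ∀ (w : List RealL2) (m : ℕ), w.length < m → word w vacuum m = 0 := by
    intro w
    induction w with
    | nil =>
      intro m hm
      have : word [] vacuum = vacuum := by simp [word]
      rw [this]
      exact lp.single_apply_ne (E := ChaosL2) 2 0 one0 (by simpa using Nat.ne_of_gt hm)
    | cons h w ih =>
      intro m hm
      obtain ⟨m, rfl⟩ : ∃ k, m = k + 1 := ⟨m - 1, by omega⟩
      rw [List.length_cons] at hm
      rw [word_cons, hadd, creation_apply_succ, ih m (by omega), ht0,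
        hadj _ _ _ (ih (m + 1 + 1) (by omega)), add_zero]
  induction w with
  | nil =>
    have : word [] vacuum = vacuum := by simp [word]
    rw [this]
    have h0 : vacuum ([] : List RealL2).length = one0 := lp.single_apply_self (E := ChaosL2) 2 0 one0
    rw [h0]; rfl
  | cons h w ih =>
    have h1 : word (h :: w) vacuum (w.length + 1)
        = tensor (complexify h) (word w vacuum w.length) := by
      rw [word_cons, hadd, creation_apply_succ,
        hadj _ _ _ (hhigh w (w.length + 1 + 1) (by omega)), add_zero]
    rw [List.map_cons, elem_cons, ← ih, creation_wignerIntegral, ← h1]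
    rfl

/-- The von Neumann algebra `SC` generated by the semicircular operators, i.e. by the free Brownian
motion `S_t = S(1_{[0,t]})`. -/
def SC : VonNeumannAlgebra Fock := generatedBy (Set.range semicircular)

/-- The vacuum state `τ(X) = ⟨XΩ, Ω⟩`. -/
def state (x : Fock →L[ℂ] Fock) : ℂ := ⟪vacuum, x vacuum⟫_ℂ

/-- The space `L²(M, τ)`, the completion of `M` for the norm `‖X‖₂ = τ(X*X)^{1/2} = ‖XΩ‖`, realised
as the closure of `MΩ` in the Fock space. -/
def gns (M : VonNeumannAlgebra Fock) : Submodule ℂ Fock :=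
  (Submodule.span ℂ ((fun x : Fock →L[ℂ] Fock => x vacuum) ''
    (M : Set (Fock →L[ℂ] Fock)))).topologicalClosure

lemma mem_generatedBy {H : Type*} [NormedAddCommGroup H] [InnerProductSpace ℂ H] [CompleteSpace H]
    {s : Set (H →L[ℂ] H)} {x : H →L[ℂ] H} (hx : x ∈ s) : x ∈ generatedBy s := by
  change x ∈ StarSubalgebra.centralizer ℂ (StarSubalgebra.centralizer ℂ s : Set (H →L[ℂ] H))
  rw [StarSubalgebra.mem_centralizer_iff]
  intro g hg
  have h1 := (StarSubalgebra.mem_centralizer_iff ℂ).1 hg x hx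
  have h2 := (StarSubalgebra.mem_centralizer_iff ℂ).1 (star_mem hg) x hx
  exact ⟨h1.1.symm, h2.1.symm⟩

lemma creation_add_smul (a b : ComplexL2) (c : ℂ) :
    creation (a + c • b) = creation a + c • creation b := by
  have ht : ∀ (n : ℕ) (f : ChaosL2 n), tensor (a + c • b) f = tensor a f + c • tensor b f := by
    intro n f
    apply Lp.ext
    filter_upwards [tensor_coe (a + c • b) f, tensor_coe a f, tensor_coe b f,
      Lp.coeFn_add (tensor a f) (c • tensor b f), Lp.coeFn_smul c (tensor b f),
      ae_head n (Lp.coeFn_add a (c • b)), ae_head n (Lp.coeFn_smul c b)] with t h1 h2 h3 h4 h5 h6 h7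
    rw [h1, h4, Pi.add_apply, h2, h5, Pi.smul_apply, h3, h6, Pi.add_apply, h7, Pi.smul_apply,
      smul_eq_mul, smul_eq_mul]
    ring
  ext1 x
  ext1; funext n
  cases n with
  | zero =>
    have : (0 : ChaosL2 0) = 0 + c • 0 := by simp
    exact this
  | succ n => exact ht n (x n)

/-- The vacuum is cyclic: `L²(SC)` is the whole Fock space. -/
lemma gns_SC : gns SC = ⊤ := by
  have hinv : ∀ (h : RealL2) (x : Fock), x ∈ gns SC → semicircular h x ∈ gns SC := by
    intro h x hx
    have hm : gns SC ≤ (gns SC).comap (semicircular h).toLinearMap := by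
      refine Submodule.topologicalClosure_minimal _ ?_ ?_
      · rw [Submodule.span_le]
        rintro _ ⟨y, hy, rfl⟩
        refine Submodule.le_topologicalClosure _ (Submodule.subset_span ⟨semicircular h * y, ?_, rfl⟩)
        exact mul_mem (mem_generatedBy ⟨h, rfl⟩ : semicircular h ∈ SC) hy
      · exact (Submodule.isClosed_topologicalClosure _).preimage (semicircular h).continuous
    exact hm hx
  have hvac : vacuum ∈ gns SC :=
    Submodule.le_topologicalClosure _ (Submodule.subset_span ⟨1, one_mem SC, rfl⟩)
  have hcre : ∀ (h : ComplexL2) (l : List ComplexL2) ,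
      (∀ l' : List ComplexL2, l'.length ≤ l.length → elem l' ∈ gns SC) →
      elem (h :: l) ∈ gns SC := by
    intro h l hl
    have hadj : ∀ k : ComplexL2, (creation k).adjoint (elem l) ∈ gns SC := by
      intro k
      cases l with
      | nil =>
        have : elem [] = vacuum := rfl
        rw [this, adjoint_creation_vacuum]; exact zero_mem _
      | cons a l =>
        rw [elem_cons, adjoint_creation_creation]
        exact Submodule.smul_mem _ _ (hl l (by simp))
    have hreal : ∀ k : RealL2, creation (complexify k) (elem l) ∈ gns SC := by
      intro k
      have h1 := sub_mem (hinv k _ (hl l le_rfl)) (hadj (complexify k))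
      simpa [semicircular] using h1
    have hdec : creation h = creation (complexify (Complex.reCLM.compLp h))
        + Complex.I • creation (complexify (Complex.imCLM.compLp h)) := by
      have hh : h = complexify (Complex.reCLM.compLp h)
          + Complex.I • complexify (Complex.imCLM.compLp h) := by
        apply Lp.ext
        unfold complexify
        filter_upwards [Lp.coeFn_add (Complex.ofRealCLM.compLp (Complex.reCLM.compLp h))
            (Complex.I • Complex.ofRealCLM.compLp (Complex.imCLM.compLp h)),
          Lp.coeFn_smul Complex.I (Complex.ofRealCLM.compLp (Complex.imCLM.compLp h)),
          ContinuousLinearMap.coeFn_compLp Complex.ofRealCLM (Complex.reCLM.compLp h),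
          ContinuousLinearMap.coeFn_compLp Complex.ofRealCLM (Complex.imCLM.compLp h),
          ContinuousLinearMap.coeFn_compLp Complex.reCLM h,
          ContinuousLinearMap.coeFn_compLp Complex.imCLM h] with t h1 h2 h3 h4 h5 h6
        rw [h1, Pi.add_apply, h2, Pi.smul_apply, h3, h4, h5, h6]
        simp only [Complex.ofRealCLM_apply, Complex.reCLM_apply, Complex.imCLM_apply, smul_eq_mul]
        rw [mul_comm]
        exact (Complex.re_add_im _).symm
      rw [← creation_add_smul, ← hh]
    rw [elem_cons, hdec]
    exact add_mem (hreal _) (Submodule.smul_mem _ _ (hreal _))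
  have hall : ∀ (n : ℕ) (l : List ComplexL2), l.length ≤ n → elem l ∈ gns SC := by
    intro n
    induction n with
    | zero =>
      intro l hl
      rw [List.length_eq_zero_iff.1 (Nat.le_zero.1 hl)]
      exact hvac
    | succ n ih =>
      intro l hl
      cases l with
      | nil => exact hvac
      | cons h l =>
        have hln : l.length ≤ n := by simpa using hl
        exact hcre h l fun l' hl' => ih l' (hl'.trans hln)
  have hle : Submodule.span ℂ (Set.range elem) ≤ gns SC := by
    rw [Submodule.span_le]
    rintro _ ⟨l, rfl⟩
    exact hall l.length l le_rfl
  have h1 := Submodule.topologicalClosure_minimal _ hle (Submodule.isClosed_topologicalClosure _)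
  rw [Submodule.dense_iff_topologicalClosure_eq_top.1 dense_span_elem] at h1
  exact top_le_iff.1 h1

instance (M : VonNeumannAlgebra Fock) : CompleteSpace (gns M) :=
  Submodule.topologicalClosure.completeSpace _

/-- The conditional expectation `τ(· | N)` on `L²(SC)`: the orthogonal projection onto `L²(N)`. It is
the extension to `L²` of the trace preserving conditional expectation (see `vnCondExp_eq`). -/
def vnCondExp (N : VonNeumannAlgebra Fock) : Fock →L[ℂ] Fock := (gns N).starProjection

/-- If `E : M → N` is a state preserving conditional expectation, then `vnCondExp N` is its extension
to `L²`. -/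
lemma vnCondExp_eq (M N : VonNeumannAlgebra Fock)
    (E : (Fock →L[ℂ] Fock) → (Fock →L[ℂ] Fock))
    (hNM : ∀ x ∈ N, x ∈ M) (hmem : ∀ x ∈ M, E x ∈ N)
    (hmod : ∀ b ∈ N, ∀ x ∈ M, E (b * x) = b * E x)
    (htr : ∀ x ∈ M, state (E x) = state x) (x : Fock →L[ℂ] Fock) (hx : x ∈ M) :
    vnCondExp N (x vacuum) = E x vacuum := by
  refine Submodule.eq_starProjection_of_mem_of_inner_eq_zero ?_ ?_
  · exact Submodule.le_topologicalClosure _ (Submodule.subset_span ⟨E x, hmem x hx, rfl⟩)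
  · intro y hy
    have hcl : IsClosed {y : Fock | ⟪x vacuum - E x vacuum, y⟫_ℂ = 0} :=
      isClosed_eq (Continuous.inner continuous_const continuous_id) continuous_const
    refine closure_minimal ?_ hcl hy
    intro z hz
    induction hz using Submodule.span_induction with
    | mem z hz =>
      obtain ⟨b, hb, rfl⟩ := hz
      have hb' : star b ∈ N := star_mem hb
      have h1 := hmod _ hb' x hx
      have h2 := htr _ (mul_mem (hNM _ hb') hx)
      rw [h1] at h2
      have h3 : ∀ y : Fock →L[ℂ] Fock, state (star b * y) = ⟪b vacuum, y vacuum⟫_ℂ := fun y =>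
        ContinuousLinearMap.adjoint_inner_right b vacuum (y vacuum)
      rw [h3, h3] at h2
      refine inner_eq_zero_symm.1 ?_
      change ⟪b vacuum, x vacuum - E x vacuum⟫_ℂ = 0
      rw [inner_sub_right, h2, sub_self]
    | zero => simp
    | add a b _ _ ha hb =>
      simp only [Set.mem_ofPred_eq, inner_add_right] at *
      rw [ha, hb, add_zero]
    | smul c a _ ha =>
      simp only [Set.mem_ofPred_eq, inner_smul_right] at *
      rw [ha, mul_zero]

/-- The von Neumann algebra `F_A` generated by the `S(1_B)`, for `B ⊆ A` Borel of finite Lebesgue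
measure. -/
def borelAlgebra (A : Set ℝ) : VonNeumannAlgebra Fock :=
  generatedBy {T | ∃ (B : Set ℝ) (hB : MeasurableSet B) (hμB : halfLine B ≠ ∞), B ⊆ A ∧
    T = semicircular (indicatorConstLp 2 hB hμB 1)}

/-- The space `L²(N ⊗ Nᵒᵖ, τ ⊗ τᵒᵖ)`, i.e. the closed span of the vectors `xΩ ⊗ yΩ`, `x, y ∈ N`, in
`L²(SC) ⊗ L²(SC)`. -/
def gnsTensor (N : VonNeumannAlgebra Fock) : Submodule ℂ FockTensor :=
  (Submodule.span ℂ {v | ∃ x ∈ N, ∃ y ∈ N, v = tmul (x vacuum) (y vacuum)}).topologicalClosure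

instance (N : VonNeumannAlgebra Fock) : CompleteSpace (gnsTensor N) :=
  Submodule.topologicalClosure.completeSpace _

/-- The conditional expectation `τ ⊗ τ(· | N)` on `L²(SC) ⊗ L²(SC)`, i.e. the conditional expectation
onto `N ⊗ Nᵒᵖ`: the orthogonal projection onto `L²(N ⊗ Nᵒᵖ)`. -/
def vnCondExpTensor (N : VonNeumannAlgebra Fock) : FockTensor →L[ℂ] FockTensor :=
  (gnsTensor N).starProjection

/-- The function `f · 1_A^{⊗n}`. -/
def cutoff {A : Set ℝ} (hA : MeasurableSet A) {n : ℕ} (f : ChaosL2 n) : ChaosL2 n :=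
  ((Lp.memLp f).indicator
    (MeasurableSet.univ_pi fun _ : Fin n => hA)).toLp _

end

end FreeWigner

open FreeWigner

/-! Let P be the second quantization of multiplication by 1_A, so that P multiplies the n-th chaos
by 1_A^{⊗n}. The whole statement reduces to the identity τ(·|F_A) = P (`vnCondExp_borelAlgebra`). P
is a symmetric idempotent, so only its range matters. On one side, P commutes with S(1_B) for B ⊆ A
and fixes Ω; it therefore lies in the commutant of F_A and fixes xΩ for every x in F_A. On the other
side, L²(F_A) is stable under every S(1_A h), and subtracting the annihilation term from S(h) turns
this into membership of all elementary tensors of functions 1_A h; these span the range of P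
densely. The chaos expansion of τ(F|F_A) is then the degreewise formula for P together with
continuity.

For the gradient, `vnCondExpTensor_tmul` shows that τ ⊗ τ(·|F_A) acts as P ⊗ P on elementary
tensors. The gradient deletes one variable: ⟨h·(f ⊗ g), ∇F⟩ = ⟨f ⊗ h ⊗ g, F⟩ for elementary tensors
f, g. This formula determines ∇F from F. Moving P to the test vectors shows that it passes from (F,
∇F) to (PF, 1_A·(P ⊗ P)∇F) (`SatisfiesIntegrationByParts.condExp`).

The formula alone does not put PF in the domain. For a word in the S(h), however, P applied to it is
a finite combination of elementary tensors, hence of words, hence lies in the domain; uniqueness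
then identifies its gradient. Both maps are bounded, so the inclusion of graphs extends to the
closure (`condExp_mem_malliavinGraph`). -/

namespace FreeWigner

noncomputable section

/-! ### Multiplication by an indicator function on L². -/

section RestrictLp

variable {X E : Type*} [MeasurableSpace X] {μ : Measure X} [NormedAddCommGroup E]
  (𝕜 : Type*) [RCLike 𝕜] {s : Set X} (hs : MeasurableSet s)

lemma coeFn_indicator_toLp (f : Lp E 2 μ) :
    (((Lp.memLp f).indicator hs).toLp _ : Lp E 2 μ) =ᵐ[μ] s.indicator f :=
  MemLp.coeFn_toLp _

/-- Multiplication by the indicator function of a measurable set, as an operator on `L²`. -/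
def restrictLp [NormedSpace 𝕜 E] : Lp E 2 μ →L[𝕜] Lp E 2 μ :=
  LinearMap.mkContinuous
    { toFun := fun f => ((Lp.memLp f).indicator hs).toLp _
      map_add' := fun f g => by
        apply Lp.ext
        filter_upwards [coeFn_indicator_toLp hs (f + g), coeFn_indicator_toLp hs f,
          coeFn_indicator_toLp hs g, Lp.coeFn_add f g,
          Lp.coeFn_add (((Lp.memLp f).indicator hs).toLp _ : Lp E 2 μ)
            (((Lp.memLp g).indicator hs).toLp _)] with t h1 h2 h3 h4 h5
        rw [h1, h5, Pi.add_apply, h2, h3]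
        by_cases ht : t ∈ s
        · simp only [Set.indicator_of_mem ht, h4, Pi.add_apply]
        · simp only [Set.indicator_of_notMem ht, add_zero]
      map_smul' := fun c f => by
        apply Lp.ext
        filter_upwards [coeFn_indicator_toLp hs (c • f), coeFn_indicator_toLp hs f,
          Lp.coeFn_smul c f,
          Lp.coeFn_smul c (((Lp.memLp f).indicator hs).toLp _ : Lp E 2 μ)] with t h1 h2 h3 h4
        rw [h1, RingHom.id_apply, h4, Pi.smul_apply, h2]
        by_cases ht : t ∈ s
        · simp only [Set.indicator_of_mem ht, h3, Pi.smul_apply]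
        · simp only [Set.indicator_of_notMem ht, smul_zero] }
    1 (fun f => by
      rw [one_mul]
      apply Lp.norm_le_norm_of_ae_le
      filter_upwards [coeFn_indicator_toLp hs f] with t ht
      change ‖(((Lp.memLp f).indicator hs).toLp _ : Lp E 2 μ) t‖ ≤ _
      rw [ht]
      exact norm_indicator_le_norm_self _ _)

lemma coeFn_restrictLp [NormedSpace 𝕜 E] (f : Lp E 2 μ) :
    restrictLp 𝕜 hs f =ᵐ[μ] s.indicator f :=
  coeFn_indicator_toLp hs f

lemma norm_restrictLp_le [NormedSpace 𝕜 E] (f : Lp E 2 μ) : ‖restrictLp 𝕜 hs f‖ ≤ ‖f‖ := by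
  apply Lp.norm_le_norm_of_ae_le
  filter_upwards [coeFn_restrictLp 𝕜 hs f] with t ht
  rw [ht]
  exact norm_indicator_le_norm_self _ _

lemma restrictLp_restrictLp [NormedSpace 𝕜 E] (f : Lp E 2 μ) :
    restrictLp 𝕜 hs (restrictLp 𝕜 hs f) = restrictLp 𝕜 hs f := by
  apply Lp.ext
  filter_upwards [coeFn_restrictLp 𝕜 hs (restrictLp 𝕜 hs f), coeFn_restrictLp 𝕜 hs f] with t h1 h2
  rw [h1]
  by_cases ht : t ∈ s <;> simp [ht, h2]

lemma inner_restrictLp_left [InnerProductSpace 𝕜 E] (f g : Lp E 2 μ) :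
    inner 𝕜 (restrictLp 𝕜 hs f) g = inner 𝕜 f (restrictLp 𝕜 hs g) := by
  rw [L2.inner_def, L2.inner_def]
  apply integral_congr_ae
  filter_upwards [coeFn_restrictLp 𝕜 hs f, coeFn_restrictLp 𝕜 hs g] with t h1 h2
  rw [h1, h2]
  by_cases ht : t ∈ s <;> simp [ht]

end RestrictLp

/-! ### Compatibility of the cutoff with complexification, indicators and tensors. -/

lemma complexify_restrictLp {A : Set ℝ} (hA : MeasurableSet A) (h : RealL2) :
    complexify (restrictLp ℝ hA h) = restrictLp ℂ hA (complexify h) := by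
  apply Lp.ext
  unfold complexify
  filter_upwards [coeFn_restrictLp ℝ hA h,
    coeFn_restrictLp ℂ hA (Complex.ofRealCLM.compLp h),
    ContinuousLinearMap.coeFn_compLp Complex.ofRealCLM h,
    ContinuousLinearMap.coeFn_compLp Complex.ofRealCLM (restrictLp ℝ hA h)] with t h1 h2 h3 h4
  rw [h4, h2, h1]
  by_cases ht : t ∈ A <;> simp [ht, h3]

/-- Supplies the hypothesis of `cutoffFock_semicircular` for the generators of F_A. -/
lemma restrictLp_indicatorConstLp_of_subset {A B : Set ℝ} (hA : MeasurableSet A)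
    (hB : MeasurableSet B) (hμB : halfLine B ≠ ∞) (hBA : B ⊆ A) :
    restrictLp ℝ hA (indicatorConstLp 2 hB hμB (1 : ℝ)) = indicatorConstLp 2 hB hμB 1 := by
  apply Lp.ext
  filter_upwards [coeFn_restrictLp ℝ hA (indicatorConstLp 2 hB hμB (1 : ℝ)),
    indicatorConstLp_coeFn (p := 2) (hs := hB) (hμs := hμB) (c := (1 : ℝ))] with t h1 h2
  rw [h1]
  by_cases ht : t ∈ A
  · simp [ht]
  · rw [h2, Set.indicator_of_notMem ht, Set.indicator_of_notMem fun h => ht (hBA h)]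

lemma cutoff_eq_restrictLp {A : Set ℝ} (hA : MeasurableSet A) {n : ℕ} (f : ChaosL2 n) :
    cutoff hA f = restrictLp ℂ (MeasurableSet.univ_pi fun _ : Fin n => hA) f := rfl

lemma cutoff_tensor {A : Set ℝ} (hA : MeasurableSet A) {n : ℕ} (h : ComplexL2) (f : ChaosL2 n) :
    cutoff hA (tensor h f) = tensor (restrictLp ℂ hA h) (cutoff hA f) := by
  simp only [cutoff_eq_restrictLp]
  apply Lp.ext
  filter_upwards [coeFn_restrictLp ℂ (MeasurableSet.univ_pi fun _ : Fin (n + 1) => hA) (tensor h f),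
    tensor_coe h f, tensor_coe (restrictLp ℂ hA h)
      (restrictLp ℂ (MeasurableSet.univ_pi fun _ : Fin n => hA) f),
    ae_head n (coeFn_restrictLp ℂ hA h),
    ae_tail (coeFn_restrictLp ℂ (MeasurableSet.univ_pi fun _ : Fin n => hA) f)]
    with t h1 h2 h3 h4 h5
  rw [h1, h3, h4, h5]
  -- The indicator of A^{n+1} factors into that of the first coordinate and that of the remaining
  -- ones.
  have hiff : t ∈ Set.univ.pi (fun _ : Fin (n + 1) => A) ↔
      t 0 ∈ A ∧ (fun i : Fin n => t i.succ) ∈ Set.univ.pi (fun _ : Fin n => A) := by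
    simp [Set.mem_pi, Fin.forall_fin_succ]
  by_cases ht0 : t 0 ∈ A <;>
    by_cases ht1 : (fun i : Fin n => t i.succ) ∈ Set.univ.pi (fun _ : Fin n => A)
  · rw [Set.indicator_of_mem (hiff.2 ⟨ht0, ht1⟩), Set.indicator_of_mem ht0,
      Set.indicator_of_mem ht1, h2]
  · rw [Set.indicator_of_notMem fun h => ht1 (hiff.1 h).2, Set.indicator_of_notMem ht1, mul_zero]
  · rw [Set.indicator_of_notMem fun h => ht0 (hiff.1 h).1, Set.indicator_of_notMem ht0, zero_mul]
  · rw [Set.indicator_of_notMem fun h => ht0 (hiff.1 h).1, Set.indicator_of_notMem ht0, zero_mul]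

/-- The empty product of copies of A is the whole one-point space, so constants are untouched; this
is why the vacuum is fixed. -/
lemma cutoff_zero_dim {A : Set ℝ} (hA : MeasurableSet A) (f : ChaosL2 0) : cutoff hA f = f := by
  rw [cutoff_eq_restrictLp]
  apply Lp.ext
  filter_upwards [coeFn_restrictLp ℂ (MeasurableSet.univ_pi fun _ : Fin 0 => hA) f] with t ht
  rw [ht, Set.indicator_of_mem]
  simp [Set.mem_pi]

/-! ### The second quantization of 1_A and its commutation with F_A. -/

/-- The second quantization of the multiplication by `1_A`: it acts on the `n`-th chaos as
multiplication by `1_A^{⊗n}`. -/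
def cutoffFock {A : Set ℝ} (hA : MeasurableSet A) : Fock →L[ℂ] Fock :=
  LinearMap.mkContinuous
    { toFun := fun x => ⟨fun n => cutoff hA (x n), (lp.memℓp x).mono' fun n =>
        norm_restrictLp_le ℂ (MeasurableSet.univ_pi fun _ : Fin n => hA) (x n)⟩
      map_add' := fun x y => by
        ext1; funext n
        exact map_add (restrictLp ℂ (MeasurableSet.univ_pi fun _ : Fin n => hA)) (x n) (y n)
      map_smul' := fun c x => by
        ext1; funext n
        exact map_smul (restrictLp ℂ (MeasurableSet.univ_pi fun _ : Fin n => hA)) c (x n) }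
    1 (fun x => by
      rw [one_mul]
      exact lp.norm_mono two_ne_zero fun n =>
        norm_restrictLp_le ℂ (MeasurableSet.univ_pi fun _ : Fin n => hA) (x n))

section CutoffFock

variable {A : Set ℝ} (hA : MeasurableSet A)

lemma cutoffFock_apply (x : Fock) (n : ℕ) : cutoffFock hA x n = cutoff hA (x n) := rfl

lemma cutoffFock_cutoffFock (x : Fock) : cutoffFock hA (cutoffFock hA x) = cutoffFock hA x := by
  ext1; funext n
  exact restrictLp_restrictLp ℂ (MeasurableSet.univ_pi fun _ : Fin n => hA) (x n)

lemma inner_cutoffFock_left (x y : Fock) :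
    ⟪cutoffFock hA x, y⟫_ℂ = ⟪x, cutoffFock hA y⟫_ℂ := by
  rw [lp.inner_eq_tsum, lp.inner_eq_tsum]
  exact tsum_congr fun n =>
    inner_restrictLp_left ℂ (MeasurableSet.univ_pi fun _ : Fin n => hA) (x n) (y n)

lemma cutoffFock_wignerIntegral (n : ℕ) (f : ChaosL2 n) :
    cutoffFock hA (wignerIntegral n f) = wignerIntegral n (cutoff hA f) := by
  ext1; funext m
  rw [cutoffFock_apply]
  unfold wignerIntegral
  by_cases hm : m = n
  · subst hm
    rw [lp.single_apply_self, lp.single_apply_self]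
  · rw [lp.single_apply_ne (E := ChaosL2) 2 n f hm,
      lp.single_apply_ne (E := ChaosL2) 2 n (cutoff hA f) hm]
    exact map_zero (restrictLp ℂ (MeasurableSet.univ_pi fun _ : Fin m => hA))

lemma cutoffFock_vacuum : cutoffFock hA vacuum = vacuum := by
  unfold vacuum
  rw [cutoffFock_wignerIntegral, cutoff_zero_dim]

lemma cutoffFock_creation (h : ComplexL2) (x : Fock) :
    cutoffFock hA (creation h x) = creation (restrictLp ℂ hA h) (cutoffFock hA x) := by
  ext1; funext n
  cases n with
  | zero =>
    exact map_zero (restrictLp ℂ (MeasurableSet.univ_pi fun _ : Fin 0 => hA))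
  | succ n => exact cutoff_tensor hA h (x n)

lemma cutoffFock_elem (f : List ComplexL2) :
    cutoffFock hA (elem f) = elem (f.map (restrictLp ℂ hA)) := by
  induction f with
  | nil => exact cutoffFock_vacuum hA
  | cons h f ih => rw [elem_cons, cutoffFock_creation, ih, List.map_cons, elem_cons]

/-- The cutoff turns ℓ(h) into ℓ(1_A h), so it commutes with ℓ(h) when h is supported in A; its
symmetry transfers this to ℓ(h)*. -/
lemma cutoffFock_semicircular (h : RealL2) (hh : restrictLp ℝ hA h = h) (x : Fock) :
    cutoffFock hA (semicircular h x) = semicircular h (cutoffFock hA x) := by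
  have hc : restrictLp ℂ hA (complexify h) = complexify h := by rw [← complexify_restrictLp, hh]
  have h1 : ∀ y, cutoffFock hA (creation (complexify h) y)
      = creation (complexify h) (cutoffFock hA y) := fun y => by rw [cutoffFock_creation, hc]
  have h2 : cutoffFock hA ((creation (complexify h)).adjoint x)
      = (creation (complexify h)).adjoint (cutoffFock hA x) := by
    refine ext_inner_left ℂ fun y => ?_
    rw [← inner_cutoffFock_left, ContinuousLinearMap.adjoint_inner_right, ← h1,
      inner_cutoffFock_left, ContinuousLinearMap.adjoint_inner_right]
  simp only [semicircular, add_apply, map_add, h1, h2]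

/-- The cutoff lies in the commutant of the generators, hence commutes with every element of the
bicommutant; evaluating at the vacuum, which it fixes, gives the claim. -/
lemma cutoffFock_apply_vacuum_of_mem {x : Fock →L[ℂ] Fock} (hx : x ∈ borelAlgebra A) :
    cutoffFock hA (x vacuum) = x vacuum := by
  have hP : cutoffFock hA ∈ StarSubalgebra.centralizer ℂ
      {T | ∃ (B : Set ℝ) (hB : MeasurableSet B) (hμB : halfLine B ≠ ∞), B ⊆ A ∧
        T = semicircular (indicatorConstLp 2 hB hμB 1)} := by
    rw [StarSubalgebra.mem_centralizer_iff]
    rintro _ ⟨B, hB, hμB, hBA, rfl⟩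
    -- Membership in the commutant asks for commutation with adjoints too; the generators being
    -- self-adjoint, one identity serves twice.
    have hsa : star (semicircular (indicatorConstLp 2 hB hμB 1))
        = semicircular (indicatorConstLp 2 hB hμB 1) :=
      ((ContinuousLinearMap.eq_adjoint_iff _ _).2 fun x y => (inner_semicircular _ x y).symm).symm
    have hcomm : semicircular (indicatorConstLp 2 hB hμB 1) * cutoffFock hA
        = cutoffFock hA * semicircular (indicatorConstLp 2 hB hμB 1) := by
      ext1 y
      exact (cutoffFock_semicircular hA _
        (restrictLp_indicatorConstLp_of_subset hA hB hμB hBA) y).symm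
    rw [hsa]
    exact ⟨hcomm, hcomm⟩
  have hx' : x ∈ StarSubalgebra.centralizer ℂ (StarSubalgebra.centralizer ℂ
      {T | ∃ (B : Set ℝ) (hB : MeasurableSet B) (hμB : halfLine B ≠ ∞), B ⊆ A ∧
        T = semicircular (indicatorConstLp 2 hB hμB 1)} : Set (Fock →L[ℂ] Fock)) := hx
  have h1 := ((StarSubalgebra.mem_centralizer_iff ℂ).1 hx' _ hP).1
  have h2 := DFunLike.congr_fun h1 vacuum
  rw [mul_apply_eq_comp, mul_apply_eq_comp, cutoffFock_vacuum] at h2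
  exact h2

end CutoffFock

/-! ### Linearity and norm continuity of h ↦ S(h). -/

/-- `h ↦ ℓ(h)` as a bounded linear map. -/
def creationL : ComplexL2 →L[ℂ] Fock →L[ℂ] Fock :=
  LinearMap.mkContinuous
    { toFun := creation
      map_add' := fun a b => by simpa using creation_add_smul a b 1
      map_smul' := fun c a => by
        have h0 : creation 0 = 0 := by simpa using creation_add_smul 0 0 1
        simpa [h0] using creation_add_smul 0 a c }
    1 (fun h => by
      rw [one_mul]
      refine ContinuousLinearMap.opNorm_le_bound _ (norm_nonneg h) fun x => le_of_eq ?_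
      exact (pow_left_inj₀ (norm_nonneg _) (by positivity) two_ne_zero).1
        ((hasSum_norm_sq (creation h x)).unique (hasSum_creationFun h x)))

lemma creationL_apply (h : ComplexL2) : creationL h = creation h := rfl

lemma complexify_eq_compLpL (h : RealL2) :
    complexify h = ContinuousLinearMap.compLpL 2 halfLine Complex.ofRealCLM h := rfl

lemma semicircular_add (h h' : RealL2) :
    semicircular (h + h') = semicircular h + semicircular h' := by
  simp only [semicircular, complexify_eq_compLpL, map_add, ← creationL_apply]
  abel

lemma semicircular_smul (c : ℝ) (h : RealL2) :
    semicircular (c • h) = (c : ℂ) • semicircular h := by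
  have h1 : complexify (c • h) = (c : ℂ) • complexify h := by
    simp only [complexify_eq_compLpL, map_smul]
    exact (Complex.coe_smul c _).symm
  simp only [semicircular, h1, ← creationL_apply, map_smul, map_smulₛₗ, Complex.conj_ofReal,
    smul_add]

lemma continuous_semicircular : Continuous semicircular := by
  have h1 : Continuous fun h : RealL2 => creationL (complexify h) :=
    creationL.continuous.comp
      (ContinuousLinearMap.compLpL 2 halfLine Complex.ofRealCLM).continuous
  exact h1.add (ContinuousLinearMap.adjoint.continuous.comp h1)

lemma complexify_re_add_im (h : ComplexL2) :
    h = complexify (Complex.reCLM.compLp h) + Complex.I • complexify (Complex.imCLM.compLp h) := by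
  apply Lp.ext
  unfold complexify
  filter_upwards [Lp.coeFn_add (Complex.ofRealCLM.compLp (Complex.reCLM.compLp h))
      (Complex.I • Complex.ofRealCLM.compLp (Complex.imCLM.compLp h)),
    Lp.coeFn_smul Complex.I (Complex.ofRealCLM.compLp (Complex.imCLM.compLp h)),
    ContinuousLinearMap.coeFn_compLp Complex.ofRealCLM (Complex.reCLM.compLp h),
    ContinuousLinearMap.coeFn_compLp Complex.ofRealCLM (Complex.imCLM.compLp h),
    ContinuousLinearMap.coeFn_compLp Complex.reCLM h,
    ContinuousLinearMap.coeFn_compLp Complex.imCLM h] with t h1 h2 h3 h4 h5 h6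
  rw [h1, Pi.add_apply, h2, Pi.smul_apply, h3, h4, h5, h6]
  simp only [Complex.ofRealCLM_apply, Complex.reCLM_apply, Complex.imCLM_apply, smul_eq_mul]
  rw [mul_comm]
  exact (Complex.re_add_im _).symm

/-! ### Elementary tensors versus words in semicircular operators. -/

/-- Elementary tensors are complex linear combinations of tensors of real functions. -/
lemma elem_mem_span_real (f : List ComplexL2) :
    elem f ∈ Submodule.span ℂ (Set.range fun l : List RealL2 => elem (l.map complexify)) := by
  have hreal : ∀ (h : RealL2) (x : Fock),
      x ∈ Submodule.span ℂ (Set.range fun l : List RealL2 => elem (l.map complexify)) →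
      creation (complexify h) x
        ∈ Submodule.span ℂ (Set.range fun l : List RealL2 => elem (l.map complexify)) := by
    intro h x hx
    induction hx using Submodule.span_induction with
    | mem x hx =>
      obtain ⟨l, rfl⟩ := hx
      exact Submodule.subset_span ⟨h :: l, rfl⟩
    | zero => rw [map_zero]; exact zero_mem _
    | add a b _ _ ha hb => rw [map_add]; exact add_mem ha hb
    | smul c a _ ha => rw [map_smul]; exact Submodule.smul_mem _ _ ha
  induction f with
  | nil => exact Submodule.subset_span ⟨[], rfl⟩
  | cons h f ih =>
    rw [elem_cons, complexify_re_add_im h, creation_add_smul]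
    exact add_mem (hreal _ _ ih) (Submodule.smul_mem _ _ (hreal _ _ ih))

/-- A subspace containing the vacuum and stable under `S(h)` for `h` in a given set contains all the
elementary tensors of elements of this set. -/
lemma elem_map_complexify_mem (K : Submodule ℂ Fock) (hvac : vacuum ∈ K) (R : Set RealL2)
    (hR : ∀ h ∈ R, ∀ x ∈ K, semicircular h x ∈ K) :
    ∀ l : List RealL2, (∀ h ∈ l, h ∈ R) → elem (l.map complexify) ∈ K
  | [], _ => hvac
  -- For a single factor the annihilation term kills the vacuum, so there is nothing to subtract.
  | [h], hl => by
    have h1 := hR h (hl h (by simp)) _ hvac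
    simp only [semicircular, add_apply, adjoint_creation_vacuum, add_zero] at h1
    exact h1
  | h :: a :: l, hl => by
    have h1 := hR h (hl h (by simp)) _
      (elem_map_complexify_mem K hvac R hR (a :: l) fun b hb => hl b (by simp_all))
    have h2 := elem_map_complexify_mem K hvac R hR l fun b hb => hl b (by simp_all)
    simp only [List.map_cons, elem_cons, semicircular, add_apply, adjoint_creation_creation] at h1 ⊢
    -- S(h) also produces ⟨h, a⟩ times the tensor two factors shorter, as in the Chebyshev
    -- recursion; hence the descent by both one and two factors.
    have h3 := sub_mem h1
      (Submodule.smul_mem K ⟪complexify h, complexify a⟫_ℂ h2)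
    rwa [add_sub_cancel_right] at h3

/-- The spans are algebraic, with no closure: only finite combinations of words are known to lie in
the domain of ∇ before any estimate on gradients. -/
lemma span_elem_le_span_word :
    Submodule.span ℂ (Set.range elem)
      ≤ Submodule.span ℂ (Set.range fun w : List RealL2 => word w vacuum) := by
  have h1 : ∀ l : List RealL2, elem (l.map complexify)
      ∈ Submodule.span ℂ (Set.range fun w : List RealL2 => word w vacuum) := by
    intro l
    have hvac : vacuum ∈ Submodule.span ℂ (Set.range fun w : List RealL2 => word w vacuum) :=
      Submodule.subset_span ⟨[], by simp [word]⟩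
    refine elem_map_complexify_mem _ hvac Set.univ ?_ l fun _ _ => trivial
    intro h _ x hx
    induction hx using Submodule.span_induction with
    | mem x hx =>
      obtain ⟨w, rfl⟩ := hx
      exact Submodule.subset_span ⟨h :: w, word_cons h w vacuum⟩
    | zero => rw [map_zero]; exact zero_mem _
    | add a b _ _ ha hb => rw [map_add]; exact add_mem ha hb
    | smul c a _ ha => rw [map_smul]; exact Submodule.smul_mem _ _ ha
  rw [Submodule.span_le]
  rintro _ ⟨f, rfl⟩
  refine Submodule.span_le.2 ?_ (elem_mem_span_real f)
  rintro _ ⟨l, rfl⟩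
  exact h1 l

/-- S(h) preserves the span: ℓ(h) prepends a factor, while ℓ(h)* contracts the first factor or kills
the vacuum. -/
lemma word_mem_span_elem (w : List RealL2) :
    word w vacuum ∈ Submodule.span ℂ (Set.range elem) := by
  induction w with
  | nil => exact Submodule.subset_span ⟨[], by simp [word]; rfl⟩
  | cons h w ih =>
    rw [word_cons]
    generalize word w vacuum = x at ih
    induction ih using Submodule.span_induction with
    | mem x hx =>
      obtain ⟨l, rfl⟩ := hx
      refine add_mem (Submodule.subset_span ⟨complexify h :: l, rfl⟩) ?_
      cases l with
      | nil =>
        have : elem [] = vacuum := rfl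
        rw [this]
        change (creation (complexify h)).adjoint vacuum ∈ _
        rw [adjoint_creation_vacuum]
        exact zero_mem _
      | cons a l =>
        change (creation (complexify h)).adjoint (creation a (elem l)) ∈ _
        rw [adjoint_creation_creation]
        exact Submodule.smul_mem _ _ (Submodule.subset_span ⟨l, rfl⟩)
    | zero => rw [map_zero]; exact zero_mem _
    | add a b _ _ ha hb => rw [map_add]; exact add_mem ha hb
    | smul c a _ ha => rw [map_smul]; exact Submodule.smul_mem _ _ ha

/-! ### Identification of τ(·|F_A) with the second quantization of 1_A. -/

lemma apply_mem_gns {M : VonNeumannAlgebra Fock} {y : Fock →L[ℂ] Fock} (hy : y ∈ M)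
    {x : Fock} (hx : x ∈ gns M) : y x ∈ gns M := by
  have hm : gns M ≤ (gns M).comap y.toLinearMap := by
    refine Submodule.topologicalClosure_minimal _ ?_ ?_
    · rw [Submodule.span_le]
      rintro _ ⟨z, hz, rfl⟩
      exact Submodule.le_topologicalClosure _ (Submodule.subset_span ⟨y * z, mul_mem hy hz, rfl⟩)
    · exact (Submodule.isClosed_topologicalClosure _).preimage y.continuous
  exact hm hx

/-- F_A is generated by indicators only, so general functions are reached by approximation: 1_A ·
c1_s = c1_{A ∩ s} is a multiple of a generator's symbol, and the property is additive and closed in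
h. -/
lemma semicircular_restrictLp_mem_gns {A : Set ℝ} (hA : MeasurableSet A) (h : RealL2) :
    ∀ x ∈ gns (borelAlgebra A), semicircular (restrictLp ℝ hA h) x ∈ gns (borelAlgebra A) := by
  induction h using Lp.induction (by norm_num : (2 : ℝ≥0∞) ≠ ∞) with
  | @indicatorConst c s hs hμs =>
    intro x hx
    have hμ : halfLine (A ∩ s) ≠ ∞ := ((measure_mono Set.inter_subset_right).trans_lt hμs).ne
    have heq : restrictLp ℝ hA (Lp.simpleFunc.indicatorConst 2 hs hμs.ne c : RealL2)
        = c • indicatorConstLp 2 (hA.inter hs) hμ (1 : ℝ) := by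
      rw [Lp.simpleFunc.coe_indicatorConst]
      apply Lp.ext
      filter_upwards [coeFn_restrictLp ℝ hA (indicatorConstLp 2 hs hμs.ne c),
        indicatorConstLp_coeFn (p := 2) (hs := hs) (hμs := hμs.ne) (c := c),
        indicatorConstLp_coeFn (p := 2) (hs := hA.inter hs) (hμs := hμ) (c := (1 : ℝ)),
        Lp.coeFn_smul c (indicatorConstLp 2 (hA.inter hs) hμ (1 : ℝ))] with t h1 h2 h3 h4
      rw [h1, h4, Pi.smul_apply, h3]
      by_cases htA : t ∈ A <;> by_cases hts : t ∈ s <;> simp [htA, hts, h2]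
    rw [heq, semicircular_smul]
    have hmem : semicircular (indicatorConstLp 2 (hA.inter hs) hμ (1 : ℝ)) ∈ borelAlgebra A :=
      mem_generatedBy ⟨_, hA.inter hs, hμ, Set.inter_subset_left, rfl⟩
    exact Submodule.smul_mem _ _ (apply_mem_gns hmem hx)
  | add hf hg _ ihf ihg =>
    intro x hx
    rw [map_add, semicircular_add]
    exact add_mem (ihf x hx) (ihg x hx)
  | isClosed =>
    simp only [Set.ofPred_forall]
    refine isClosed_iInter fun x => isClosed_iInter fun _ => ?_
    -- For fixed x, the admissible h form the preimage of a closed subspace under h ↦ S(1_A h)x.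
    refine (Submodule.isClosed_topologicalClosure _).preimage (f := fun h : RealL2 =>
      semicircular (restrictLp ℝ hA h) x) ?_
    exact (continuous_semicircular.comp (restrictLp ℝ hA).continuous).clm_apply continuous_const

/-- On real elementary tensors the cutoff replaces each factor h by 1_A h, and
`elem_map_complexify_mem` applies with these functions; density and continuity give the rest. -/
lemma cutoffFock_mem_gns {A : Set ℝ} (hA : MeasurableSet A) (x : Fock) :
    cutoffFock hA x ∈ gns (borelAlgebra A) := by
  have hle : Submodule.span ℂ (Set.range elem)
      ≤ (gns (borelAlgebra A)).comap (cutoffFock hA).toLinearMap := by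
    rw [Submodule.span_le]
    rintro _ ⟨f, rfl⟩
    refine Submodule.span_le.2 ?_ (elem_mem_span_real f)
    rintro _ ⟨l, rfl⟩
    change cutoffFock hA (elem (l.map complexify)) ∈ gns (borelAlgebra A)
    have hmap : (l.map complexify).map (restrictLp ℂ hA)
        = (l.map (restrictLp ℝ hA)).map complexify := by
      simp [complexify_restrictLp]
    rw [cutoffFock_elem, hmap]
    have hvac : vacuum ∈ gns (borelAlgebra A) :=
      Submodule.le_topologicalClosure _ (Submodule.subset_span ⟨1, one_mem (borelAlgebra A), rfl⟩)
    refine elem_map_complexify_mem _ hvac (Set.range (restrictLp ℝ hA)) ?_ _ ?_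
    · rintro _ ⟨h, rfl⟩
      exact semicircular_restrictLp_mem_gns hA h
    · intro h hh
      obtain ⟨a, _, rfl⟩ := List.mem_map.1 hh
      exact ⟨a, rfl⟩
  have h1 := Submodule.topologicalClosure_minimal _ hle
    ((Submodule.isClosed_topologicalClosure _).preimage (cutoffFock hA).continuous)
  rw [Submodule.dense_iff_topologicalClosure_eq_top.1 dense_span_elem] at h1
  exact h1 trivial

lemma cutoffFock_of_mem_gns {A : Set ℝ} (hA : MeasurableSet A) {x : Fock}
    (hx : x ∈ gns (borelAlgebra A)) : cutoffFock hA x = x := by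
  refine closure_minimal ?_ (isClosed_eq (cutoffFock hA).continuous continuous_id) hx
  intro z hz
  induction hz using Submodule.span_induction with
  | mem z hz =>
    obtain ⟨b, hb, rfl⟩ := hz
    exact cutoffFock_apply_vacuum_of_mem hA hb
  | zero => exact map_zero (cutoffFock hA)
  | add a b _ _ ha hb =>
    simp only [Set.mem_ofPred_eq, map_add, id] at *
    rw [ha, hb]
  | smul c a _ ha =>
    simp only [Set.mem_ofPred_eq, map_smul, id] at *
    rw [ha]

/-- The conditional expectation given `F_A` is the second quantization of `1_A`. -/
lemma vnCondExp_borelAlgebra {A : Set ℝ} (hA : MeasurableSet A) :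
    vnCondExp (borelAlgebra A) = cutoffFock hA := by
  ext1 x
  refine Submodule.eq_starProjection_of_mem_of_inner_eq_zero (cutoffFock_mem_gns hA x) ?_
  intro y hy
  -- With P the cutoff, y = Py, and symmetry moves P onto x − Px, which P annihilates by
  -- idempotence.
  rw [← cutoffFock_of_mem_gns hA hy, ← inner_cutoffFock_left, map_sub, cutoffFock_cutoffFock,
    sub_self, inner_zero_left]

/-! ### The conditional expectation on the tensor square. -/

/-- The elementary tensor `x ⊗ y` as a bounded bilinear map. -/
def tmulL : Fock →L[ℂ] Fock →L[ℂ] FockTensor :=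
  (ContinuousLinearMap.compL ℂ Fock (TensorProduct ℂ Fock Fock) FockTensor
    UniformSpace.Completion.toComplL).comp (TensorProduct.mkL ℂ Fock Fock)

/-- Closure is taken in one leg at a time: the second with the first equal to xΩ, then the first
with the second equal to b. -/
lemma tmul_mem_gnsTensor {N : VonNeumannAlgebra Fock} {a b : Fock} (ha : a ∈ gns N)
    (hb : b ∈ gns N) : tmul a b ∈ gnsTensor N := by
  have hcl : IsClosed (gnsTensor N : Set FockTensor) := Submodule.isClosed_topologicalClosure _
  have h1 : ∀ x ∈ N, gns N ≤ (gnsTensor N).comap (tmulL (x vacuum)).toLinearMap := by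
    intro x hx
    refine Submodule.topologicalClosure_minimal _ ?_ (hcl.preimage (tmulL (x vacuum)).continuous)
    rw [Submodule.span_le]
    rintro _ ⟨y, hy, rfl⟩
    exact Submodule.le_topologicalClosure _ (Submodule.subset_span ⟨x, hx, y, hy, rfl⟩)
  have h2 : gns N ≤ (gnsTensor N).comap (tmulL.flip b).toLinearMap := by
    refine Submodule.topologicalClosure_minimal _ ?_ (hcl.preimage (tmulL.flip b).continuous)
    rw [Submodule.span_le]
    rintro _ ⟨x, hx, rfl⟩
    exact h1 x hx hb
  exact h2 ha

/-- Against xΩ ⊗ yΩ with x, y in F_A the inner product factors, and in each factor the symmetric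
cutoff moves onto a vector it fixes; so the residual is orthogonal to L²(F_A ⊗ F_Aᵒᵖ). -/
lemma vnCondExpTensor_tmul {A : Set ℝ} (hA : MeasurableSet A) (a b : Fock) :
    vnCondExpTensor (borelAlgebra A) (tmul a b)
      = tmul (cutoffFock hA a) (cutoffFock hA b) := by
  refine Submodule.eq_starProjection_of_mem_of_inner_eq_zero
    (tmul_mem_gnsTensor (cutoffFock_mem_gns hA a) (cutoffFock_mem_gns hA b)) ?_
  intro v hv
  have hcl : IsClosed {v : FockTensor |
      ⟪tmul a b - tmul (cutoffFock hA a) (cutoffFock hA b), v⟫_ℂ = 0} :=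
    isClosed_eq (Continuous.inner continuous_const continuous_id) continuous_const
  refine closure_minimal ?_ hcl hv
  intro z hz
  induction hz using Submodule.span_induction with
  | mem z hz =>
    obtain ⟨x, hx, y, hy, rfl⟩ := hz
    change ⟪tmul a b - tmul (cutoffFock hA a) (cutoffFock hA b), _⟫_ℂ = 0
    rw [inner_sub_left, inner_tmul, inner_tmul, inner_cutoffFock_left, inner_cutoffFock_left,
      cutoffFock_apply_vacuum_of_mem hA hx, cutoffFock_apply_vacuum_of_mem hA hy, sub_self]
  | zero => exact inner_zero_right _
  | add a b _ _ ha hb =>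
    simp only [Set.mem_ofPred_eq, inner_add_right] at *
    rw [ha, hb, add_zero]
  | smul c a _ ha =>
    simp only [Set.mem_ofPred_eq, inner_smul_right] at *
    rw [ha, mul_zero]

/-! ### The conditional expectation of biprocesses. -/

/-- The operator `U ↦ (t ↦ 1_A(t) τ ⊗ τ(U_t | F_A))` on square integrable biprocesses. -/
def condExpBiprocess {A : Set ℝ} (hA : MeasurableSet A) : Biprocess →L[ℂ] Biprocess :=
  (restrictLp ℂ hA).comp
    (ContinuousLinearMap.compLpL 2 halfLine (vnCondExpTensor (borelAlgebra A)))

lemma coeFn_condExpBiprocess {A : Set ℝ} (hA : MeasurableSet A) (U : Biprocess) :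
    condExpBiprocess hA U =ᵐ[halfLine]
      A.indicator fun s => vnCondExpTensor (borelAlgebra A) (U s) := by
  filter_upwards [coeFn_restrictLp ℂ hA
      (ContinuousLinearMap.compLpL 2 halfLine (vnCondExpTensor (borelAlgebra A)) U),
    ContinuousLinearMap.coeFn_compLpL (p := 2) (μ := halfLine)
      (vnCondExpTensor (borelAlgebra A)) U] with t h1 h2
  refine h1.trans ?_
  by_cases ht : t ∈ A <;> simp [ht, h2]

/-- Both the time cutoff and the projection are symmetric, so they move to the test biprocess, which
keeps its product form. -/
lemma inner_simpleBiprocess_condExpBiprocess {A : Set ℝ} (hA : MeasurableSet A) (h : RealL2)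
    (v : FockTensor) (U : Biprocess) :
    ⟪simpleBiprocess h v, condExpBiprocess hA U⟫_ℂ
      = ⟪simpleBiprocess (restrictLp ℝ hA h) (vnCondExpTensor (borelAlgebra A) v), U⟫_ℂ := by
  have hsymm : ∀ u w : FockTensor, ⟪vnCondExpTensor (borelAlgebra A) u, w⟫_ℂ
      = ⟪u, vnCondExpTensor (borelAlgebra A) w⟫_ℂ :=
    fun u w => Submodule.inner_starProjection_left_eq_right _ u w
  rw [L2.inner_def, L2.inner_def]
  apply integral_congr_ae
  filter_upwards [ContinuousLinearMap.coeFn_compLp (ContinuousLinearMap.toSpanSingleton ℝ v) h,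
    ContinuousLinearMap.coeFn_compLp (ContinuousLinearMap.toSpanSingleton ℝ
      (vnCondExpTensor (borelAlgebra A) v)) (restrictLp ℝ hA h),
    coeFn_restrictLp ℝ hA h, coeFn_condExpBiprocess hA U] with t h1 h2 h3 h4
  unfold simpleBiprocess
  rw [h1, h2, h3, h4]
  by_cases ht : t ∈ A
  · simp only [Set.indicator_of_mem ht, ContinuousLinearMap.toSpanSingleton_apply]
    rw [← Complex.coe_smul, ← Complex.coe_smul, inner_smul_left, inner_smul_left, hsymm]
  · simp [ht]

/-! ### Integration by parts and stability of the graph of ∇. -/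

/-- Elements of `L²(SC) × L²(ℝ₊; L²(SC) ⊗ L²(SC))` whose components satisfy the integration by
parts formula against elementary biprocesses. -/
def SatisfiesIntegrationByParts (p : Fock × Biprocess) : Prop :=
  ∀ (h : RealL2) (f g : List ComplexL2),
    ⟪simpleBiprocess h (tmul (elem f) (elem g)), p.2⟫_ℂ = ⟪elem (f ++ complexify h :: g), p.1⟫_ℂ

/-- The elementary biprocesses used as tests are total, so the formula leaves no freedom in the
second component. -/
lemma SatisfiesIntegrationByParts.snd_eq {p q : Fock × Biprocess}
    (hp : SatisfiesIntegrationByParts p) (hq : SatisfiesIntegrationByParts q) (h : p.1 = q.1) :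
    p.2 = q.2 := by
  refine sub_eq_zero.1 (eq_zero_of_inner_simpleBiprocess _ fun a f g => ?_)
  rw [inner_sub_right, hp, hq, h, sub_self]

/-- Moved to the test side, the conditional expectations multiply h and every factor of f and g by
1_A, on both sides of the formula; what remains is the formula for p with these new test functions.
-/
lemma SatisfiesIntegrationByParts.condExp {A : Set ℝ} (hA : MeasurableSet A)
    {p : Fock × Biprocess} (hp : SatisfiesIntegrationByParts p) :
    SatisfiesIntegrationByParts (cutoffFock hA p.1, condExpBiprocess hA p.2) := by
  intro h f g
  change ⟪_, condExpBiprocess hA p.2⟫_ℂ = ⟪_, cutoffFock hA p.1⟫_ℂ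
  rw [inner_simpleBiprocess_condExpBiprocess, vnCondExpTensor_tmul hA, ← inner_cutoffFock_left,
    cutoffFock_elem, cutoffFock_elem, cutoffFock_elem, hp, complexify_restrictLp, List.map_append,
    List.map_cons]

lemma exists_mem_malliavinGraph_of_mem_span_word {x : Fock}
    (hx : x ∈ Submodule.span ℂ (Set.range fun w : List RealL2 => word w vacuum)) :
    ∃ U, (x, U) ∈ malliavinGraph := by
  have hle : Submodule.span ℂ (Set.range fun w : List RealL2 => word w vacuum)
      ≤ malliavinGraph.map (LinearMap.fst ℂ Fock Biprocess) := by
    rw [Submodule.span_le]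
    rintro _ ⟨w, rfl⟩
    exact ⟨(word w vacuum, gradWord w),
      Submodule.le_topologicalClosure _ (Submodule.subset_span ⟨w, rfl⟩), rfl⟩
  obtain ⟨⟨y, U⟩, hp, rfl⟩ := hle hx
  exact ⟨U, hp⟩

lemma cutoffFock_mem_span_elem {A : Set ℝ} (hA : MeasurableSet A) {x : Fock}
    (hx : x ∈ Submodule.span ℂ (Set.range elem)) :
    cutoffFock hA x ∈ Submodule.span ℂ (Set.range elem) := by
  have hle : Submodule.span ℂ (Set.range elem)
      ≤ (Submodule.span ℂ (Set.range elem)).comap (cutoffFock hA).toLinearMap := by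
    rw [Submodule.span_le]
    rintro _ ⟨f, rfl⟩
    exact Submodule.subset_span ⟨f.map (restrictLp ℂ hA), (cutoffFock_elem hA f).symm⟩
  exact hle hx

/-- The graph of `∇` is stable under the conditional expectations given `F_A`. -/
lemma condExp_mem_malliavinGraph {A : Set ℝ} (hA : MeasurableSet A) {p : Fock × Biprocess}
    (hp : p ∈ malliavinGraph) :
    (cutoffFock hA p.1, condExpBiprocess hA p.2) ∈ malliavinGraph := by
  have hle : malliavinGraph
      ≤ malliavinGraph.comap ((cutoffFock hA).prodMap (condExpBiprocess hA)).toLinearMap := by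
    -- The pair of maps is bounded and the graph is closed, so words suffice.
    refine Submodule.topologicalClosure_minimal _ ?_
      ((Submodule.isClosed_topologicalClosure _).preimage
        ((cutoffFock hA).prodMap (condExpBiprocess hA)).continuous)
    rw [Submodule.span_le]
    rintro _ ⟨w, rfl⟩
    change (cutoffFock hA (word w vacuum), condExpBiprocess hA (gradWord w)) ∈ malliavinGraph
    -- The cutoff of a word is again a finite combination of words, so it has some gradient U,
    -- identified below by uniqueness.
    obtain ⟨U, hU⟩ := exists_mem_malliavinGraph_of_mem_span_word
      (span_elem_le_span_word (cutoffFock_mem_span_elem hA (word_mem_span_elem w)))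
    have hw : SatisfiesIntegrationByParts (word w vacuum, gradWord w) := fun h f g =>
      (inner_gradWord _ _ h w).trans (pairing_elem h g w f)
    have hU' : SatisfiesIntegrationByParts (cutoffFock hA (word w vacuum), U) := fun h f g =>
      inner_of_mem_malliavinGraph h f g hU
    have hUeq : condExpBiprocess hA (gradWord w) = U := (hw.condExp hA).snd_eq hU' rfl
    rw [hUeq]
    exact hU
  exact hle hp

end

end FreeWigner

/-! ### The main theorem. -/

theorem mainTheorem12 (A : Set ℝ) (hA : MeasurableSet A) (hA0 : A ⊆ Set.Ici 0)
    (hAfin : volume A < ∞) (F : Fock) (hF : F ∈ D12) :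
    (∃ hE : vnCondExp (borelAlgebra A) F ∈ D12,
      ∀ᵐ t ∂halfLine, (grad ⟨vnCondExp (borelAlgebra A) F, hE⟩ : ℝ → FockTensor) t =
        A.indicator (fun s => vnCondExpTensor (borelAlgebra A) (grad ⟨F, hF⟩ s)) t) ∧
    (∀ f : (n : ℕ) → ChaosL2 n, HasSum (fun n => wignerIntegral n (f n)) F →
      HasSum (fun n => wignerIntegral n (cutoff hA (f n))) (vnCondExp (borelAlgebra A) F)) := by
  rw [vnCondExp_borelAlgebra hA]
  constructor
  · have hmem : (F, grad ⟨F, hF⟩) ∈ malliavinGraph := by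
      rw [← malliavin_graph]
      exact malliavin.mem_graph ⟨F, hF⟩
    have himg := condExp_mem_malliavinGraph hA hmem
    -- Graph membership carries both membership in the domain and the value of the gradient.
    rw [← malliavin_graph, LinearPMap.mem_graph_iff] at himg
    obtain ⟨⟨y, hy⟩, hy1, hy2⟩ := himg
    obtain rfl : y = cutoffFock hA F := hy1
    refine ⟨hy, ?_⟩
    have hgrad : grad ⟨cutoffFock hA F, hy⟩ = condExpBiprocess hA (grad ⟨F, hF⟩) := hy2
    rw [hgrad]
    exact coeFn_condExpBiprocess hA _
  · intro f hf
    -- A continuous linear map passes through the chaos sum term by term.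
    simpa only [Function.comp_def, cutoffFock_wignerIntegral] using
      (cutoffFock hA).hasSum hf
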